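/- Setting. Let $(X,\rho)$ be a quasi-metric space: $\rho:X\times X\to[0,\infty)$ is symmetric, vanishes exactly on the diagonal, and $\rho(x,y)\le K_0[\rho(x,z)+\rho(z,y)]$ for all $x,y,z\in X$ and some constant $K_0\in[1,\infty)$. Write $B(x,r):=\{y\in X:\rho(x,y)<r\}$. Let $\mu$ be a doubling measure on $X$, i.e. $\mu(B(x,2r))\le C_\mu\,\mu(B(x,r))$ for all $x\in X$, $r\in(0,\infty)$. Assume that for every $x$ the balls $\{B(x,r)\}_{r>0}$ form a basis of open neighborhoods of $x$; that $\mu$ is Borel regular (open sets are measurable and every $A\subset X$ lies in a Borel set $E$ with $\mu(A)=\mu(E)$); that $0<\mu(B(x,r))<\infty$ for all $x\in X$, $r>0$; that $\sup_{x,y\in X}\rho(x,y)=\infty$; and that $\mu(\{x\})=0$ for all $x\in X$. Assume moreover that $(X,\rho)$ has the monotone geodesic property: there is $\widetilde K>0$ such that for all $s>0$ and $x,y\in X$ with $\rho(x,y)\ge s$ there are $m\in\mathbb N$, $m\ge1$, and points $x_0=x,x_1,\dots,x_m=y$ with $\rho(x_i,x_{i+1})\le\widetilde Ks$ and $\rho(x_{i+1},x_m)\le\rho(x_i,x_m)-s$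 for $0\le i<m$. Fix $p\in(1,\infty)$ and let $\lambda:=\mu\times m$ on $X\times\mathbb R$, with $m$ the Lebesgue measure on $\mathbb R$. For averages we write $-\!\!\!\!\!\int_E g:=\lambda(E)^{-1}\int_E g\,d\lambda$. Fix an adjacent system of dyadic cubes: constants $\delta\in(0,1)$ with $96K_0^6\delta\le1$ and $0<c_0\le C_0<\infty$ with $12K_0^3C_0\delta\le c_0$, finitely many indices $\tau\in\{1,\dots,K\}$ and, for each $\tau$ and $k\in\mathbb Z$, a countable index set $I_{k,\tau}$, points $z_\alpha^{k,\tau}\in X$ and $\mu$-measurable sets $Q_\alpha^{k,\tau}\subset X$ $(\alpha\in I_{k,\tau})$ such that: $\rho(z_\alpha^{k,\tau},z_\beta^{k,\tau})\ge c_0\delta^k$ if $\alpha\ne\beta$, and every $x\in X$ satisfies $\rho(x,z^{k,\tau}_\alpha)<C_0\delta^k$ for some $\alpha$; for $l\ge k$ either $Q_\beta^{l,\tau}\subset Q_\alpha^{k,\tau}$ or $Q_\beta^{l,\tau}\cap Q_\alpha^{k,\tau}=\emptyset$; for each $k,\tau$, $X$ is the disjoint union of the $Q_\alpha^{k,\tau}$,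 $\alpha\in I_{k,\tau}$; $B(z_\alpha^{k,\tau},c_1\delta^k)\subset Q_\alpha^{k,\tau}\subset B(z_\alpha^{k,\tau},C_1\delta^k)$ with $c_1:=c_0/(3K_0^2)$, $C_1:=2K_0C_0$; if $l\ge k$ and $Q_\beta^{l,\tau}\subset Q_\alpha^{k,\tau}$ then $B(z_\beta^{l,\tau},C_1\delta^l)\subset B(z_\alpha^{k,\tau},C_1\delta^k)$; and, for some constant $C>0$, every ball $B(x,r)$ is contained in some $Q_\alpha^{k,\tau}$ of diameter at most $Cr$. Definitions. A weight is a real-valued, $\lambda$-measurable, $\lambda$-a.e. positive function $\omega$ on $X\times\mathbb R$ such that every $(x,t)$ has some $r>0$ for which $\omega$ is integrable over $B(x,r)\times(t-r^p,t+r^p)$. For $q\in(1,\infty)$, $q':=q/(q-1)$ and $\gamma\in[0,1)$, a weight $\omega$ belongs to $A_q^+(\gamma)$ if $$\sup_{x\in X,\,t\in\mathbb R,\,l>0}\left[-\!\!\!\!\!\!\int_{B(x,l)\times(t-l^p,\,t-\gamma l^p)}\omega\right]\left[-\!\!\!\!\!\!\int_{B(x,l)\times(t+\gamma l^p,\,t+l^p)}\omega^{1-q'}\right]^{q-1}<\infty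 .$$ The parabolic maximal function of $f$ is $$\mathcal M^{\gamma+}f(x,t):=\sup_{\tau,\,k,\,\alpha:\ x\in Q_\alpha^{k,\tau}}\ -\!\!\!\!\!\!\int_{Q_\alpha^{k,\tau}\times(t+\gamma\delta^{kp},\,t+\delta^{kp})}|f| ,$$ and $\mathcal M^{\gamma+}$ is said to be bounded from $L^q(\omega)$ to $L^{q,\infty}(\omega)$ if there is a constant $C<\infty$ such that, for every $\lambda$-measurable $f:X\times\mathbb R\to\mathbb C$ with $\int|f|^q\omega\,d\lambda<\infty$, the function $\mathcal M^{\gamma+}f$ is $\lambda$-measurable and $$\sup_{\xi>0}\,\xi\left[\int_{\{\mathcal M^{\gamma+}f>\xi\}}\omega\,d\lambda\right]^{1/q}\le C\left[\int_{X\times\mathbb R}|f|^q\omega\,d\lambda\right]^{1/q}.$$ Theorem. Let $q\in(1,\infty)$ and let $\omega$ be a weight on $X\times\mathbb R$. (a) The following statements are equivalent: (i) there exists $\gamma\in(0,1)$ such that $\omega\in A_q^+(\gamma)$; (ii) $\omega\in A_q^+(\gamma)$ for every $\gamma\in(0,1)$; (iii) there exists $\gamma\in(0,1)$ such that $\mathcal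 M^{\gamma+}$ is bounded from $L^q(\omega)$ to $L^{q,\infty}(\omega)$; (iv) $\mathcal M^{\gamma+}$ is bounded from $L^q(\omega)$ to $L^{q,\infty}(\omega)$ for every $\gamma\in(0,1)$. (b) (the case $\gamma=0$) $\omega\in A_q^+(0)$ if and only if $\mathcal M^{0+}$ is bounded from $L^q(\omega)$ to $L^{q,\infty}(\omega)$. -/

import Mathlib

open MeasureTheory Set Topology
open scoped ENNReal NNReal

universe u v

/-- The ball `B(x,r) = {y : ρ(x,y) < r}` of a quasi-metric `ρ`. -/
def qBall {X : Type*} (ρ : X → X → ℝ) (x : X) (r : ℝ) : Set X := {y | ρ x y < r}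

/-- `ρ` is a quasi-metric on `X` with quasi-triangle constant `K₀`. -/
structure IsQuasiMetric {X : Type*} (ρ : X → X → ℝ) (K₀ : ℝ) : Prop where
  nonneg : ∀ x y, 0 ≤ ρ x y
  eq_zero_iff : ∀ x y, ρ x y = 0 ↔ x = y
  symm : ∀ x y, ρ x y = ρ y x
  one_le_const : 1 ≤ K₀
  quasi_triangle : ∀ x y z, ρ x y ≤ K₀ * (ρ x z + ρ z y)

/-- `(X,ρ,μ)` is a space of homogeneous type, with the standing assumptions: the balls are open and
form neighbourhood bases, `μ` is doubling and Borel regular, balls have positive finite measure,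
the space is unbounded and points are null. The value of `μ` on an arbitrary set is its outer
measure, as in the usual meaning of Borel regularity. -/
structure IsHomogeneousType {X : Type*} [TopologicalSpace X] [MeasurableSpace X]
    (ρ : X → X → ℝ) (K₀ : ℝ) (μ : Measure X) : Prop where
  quasiMetric : IsQuasiMetric ρ K₀
  doubling : ∃ Cμ : ℝ≥0, 1 ≤ Cμ ∧
    ∀ (x : X) (r : ℝ), 0 < r → μ (qBall ρ x (2 * r)) ≤ (Cμ : ℝ≥0∞) * μ (qBall ρ x r)
  isOpen_ball : ∀ (x : X) (r : ℝ), 0 < r → IsOpen (qBall ρ x r)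
  nhds_basis : ∀ x : X, (𝓝 x).HasBasis (fun r : ℝ => 0 < r) (qBall ρ x)
  measurable_of_isOpen : ∀ U : Set X, IsOpen U → MeasurableSet U
  borel_regular : ∀ A : Set X, ∃ E : Set X, A ⊆ E ∧ MeasurableSet[borel X] E ∧ μ A = μ E
  ball_pos : ∀ (x : X) (r : ℝ), 0 < r → 0 < μ (qBall ρ x r)
  ball_lt_top : ∀ (x : X) (r : ℝ), 0 < r → μ (qBall ρ x r) < ∞
  unbounded : ∀ M : ℝ, ∃ x y : X, M < ρ x y
  nonatomic : ∀ x : X, μ {x} = 0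

/-- The monotone geodesic property of a quasi-metric space. -/
def MonotoneGeodesic {X : Type*} (ρ : X → X → ℝ) : Prop :=
  ∃ K : ℝ, 0 < K ∧ ∀ (s : ℝ), 0 < s → ∀ x y : X, s ≤ ρ x y →
    ∃ (m : ℕ) (u : ℕ → X), 1 ≤ m ∧ u 0 = x ∧ u m = y ∧
      ∀ i < m, ρ (u i) (u (i + 1)) ≤ K * s ∧ ρ (u (i + 1)) (u m) ≤ ρ (u i) (u m) - s

/-- An adjacent system of dyadic cubes of `(X,ρ,μ)`: finitely many dyadic systems
`{Q τ k α : k ∈ ℤ, α ∈ I τ k}`, `τ < N`, with side parameter `δ`, such that every ball is contained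
in a cube, of one of the systems, whose diameter is controlled by the radius. The cubes are
`μ`-measurable. -/
structure AdjacentDyadicSystem {X : Type u} [MeasurableSpace X]
    (ρ : X → X → ℝ) (K₀ : ℝ) (μ : Measure X) where
  /-- number of dyadic systems -/
  N : ℕ
  δ : ℝ
  c₀ : ℝ
  C₀ : ℝ
  δ_pos : 0 < δ
  δ_lt_one : δ < 1
  δ_small : 96 * K₀ ^ 6 * δ ≤ 1
  c₀_pos : 0 < c₀
  c₀_le : c₀ ≤ C₀
  const_small : 12 * K₀ ^ 3 * C₀ * δ ≤ c₀
  I : Fin N → ℤ → Type v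
  countable_index : ∀ τ k, Countable (I τ k)
  /-- dyadic points -/
  z : (τ : Fin N) → (k : ℤ) → I τ k → X
  separated : ∀ (τ : Fin N) (k : ℤ) (α β : I τ k), α ≠ β → c₀ * δ ^ k ≤ ρ (z τ k α) (z τ k β)
  net : ∀ (τ : Fin N) (k : ℤ) (x : X), ∃ α : I τ k, ρ x (z τ k α) < C₀ * δ ^ k
  /-- dyadic cubes -/
  Q : (τ : Fin N) → (k : ℤ) → I τ k → Set X
  measurable_cube : ∀ (τ : Fin N) (k : ℤ) (α : I τ k), NullMeasurableSet (Q τ k α) μ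
  nested : ∀ (τ : Fin N) (k l : ℤ), k ≤ l → ∀ (α : I τ k) (β : I τ l),
    Q τ l β ⊆ Q τ k α ∨ Disjoint (Q τ l β) (Q τ k α)
  cover : ∀ (τ : Fin N) (k : ℤ), ⋃ α : I τ k, Q τ k α = univ
  disjoint : ∀ (τ : Fin N) (k : ℤ) (α β : I τ k), α ≠ β → Disjoint (Q τ k α) (Q τ k β)
  ball_subset : ∀ (τ : Fin N) (k : ℤ) (α : I τ k),
    qBall ρ (z τ k α) (c₀ / (3 * K₀ ^ 2) * δ ^ k) ⊆ Q τ k α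
  subset_ball : ∀ (τ : Fin N) (k : ℤ) (α : I τ k),
    Q τ k α ⊆ qBall ρ (z τ k α) (2 * K₀ * C₀ * δ ^ k)
  ball_mono : ∀ (τ : Fin N) (k l : ℤ), k ≤ l → ∀ (α : I τ k) (β : I τ l), Q τ l β ⊆ Q τ k α →
    qBall ρ (z τ l β) (2 * K₀ * C₀ * δ ^ l) ⊆ qBall ρ (z τ k α) (2 * K₀ * C₀ * δ ^ k)
  adjacent : ∃ C : ℝ, 0 < C ∧ ∀ (x : X) (r : ℝ), 0 < r →
    ∃ (τ : Fin N) (k : ℤ) (α : I τ k), qBall ρ x r ⊆ Q τ k α ∧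
      ∀ y ∈ Q τ k α, ∀ w ∈ Q τ k α, ρ y w ≤ C * r

/-- The measure `λ = μ × m` on `X × ℝ`, with `m` the Lebesgue measure. -/
noncomputable def spaceTime {X : Type*} [MeasurableSpace X] (μ : Measure X) : Measure (X × ℝ) :=
  μ.prod volume

/-- The parabolic cylinder `R(x,t,l) = B(x,l) × (t - l^p, t + l^p)`. -/
def cylinder {X : Type*} (ρ : X → X → ℝ) (p : ℝ) (x : X) (t l : ℝ) : Set (X × ℝ) :=
  qBall ρ x l ×ˢ Ioo (t - l ^ p) (t + l ^ p)

/-- `R⁻(x,t,l,γ) = B(x,l) × (t - l^p, t - γ l^p)`. -/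
def cylinderMinus {X : Type*} (ρ : X → X → ℝ) (p γ : ℝ) (x : X) (t l : ℝ) : Set (X × ℝ) :=
  qBall ρ x l ×ˢ Ioo (t - l ^ p) (t - γ * l ^ p)

/-- `R⁺(x,t,l,γ) = B(x,l) × (t + γ l^p, t + l^p)`. -/
def cylinderPlus {X : Type*} (ρ : X → X → ℝ) (p γ : ℝ) (x : X) (t l : ℝ) : Set (X × ℝ) :=
  qBall ρ x l ×ˢ Ioo (t + γ * l ^ p) (t + l ^ p)

/-- A weight: a real-valued, `λ`-a.e. positive, locally integrable function on `X × ℝ`. -/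
structure IsWeight {X : Type*} [MeasurableSpace X] (ρ : X → X → ℝ) (p : ℝ) (μ : Measure X)
    (ω : X × ℝ → ℝ) : Prop where
  aemeasurable : AEMeasurable ω (spaceTime μ)
  pos : ∀ᵐ y ∂(spaceTime μ), 0 < ω y
  locallyIntegrable : ∀ (x : X) (t : ℝ), ∃ r : ℝ, 0 < r ∧
    IntegrableOn ω (cylinder ρ p x t r) (spaceTime μ)

/-- The constant `[ω]_{A_q^+(γ)}`, with values in `[0,∞]`; here `q' = q / (q - 1)`. -/
noncomputable def aqPlusConst {X : Type*} [MeasurableSpace X] (ρ : X → X → ℝ) (p : ℝ)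
    (μ : Measure X) (q γ : ℝ) (ω : X × ℝ → ℝ) : ℝ≥0∞ :=
  ⨆ (x : X) (t : ℝ) (l : ℝ) (_ : 0 < l),
    (⨍⁻ y in cylinderMinus ρ p γ x t l, ENNReal.ofReal (ω y) ∂(spaceTime μ)) *
    (⨍⁻ y in cylinderPlus ρ p γ x t l,
      ENNReal.ofReal (ω y ^ (1 - Real.conjExponent q)) ∂(spaceTime μ)) ^ (q - 1)

/-- `ω ∈ A_q^+(γ)`. -/
def MemAqPlus {X : Type*} [MeasurableSpace X] (ρ : X → X → ℝ) (p : ℝ) (μ : Measure X)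
    (q γ : ℝ) (ω : X × ℝ → ℝ) : Prop :=
  IsWeight ρ p μ ω ∧ aqPlusConst ρ p μ q γ ω < ∞

namespace AdjacentDyadicSystem

variable {X : Type*} [MeasurableSpace X] {ρ : X → X → ℝ} {K₀ : ℝ} {μ : Measure X}

/-- The parabolic rectangle `P(τ,k,α,t) = Q τ k α × (t - δ^{kp}, t + δ^{kp})`. -/
def rect (D : AdjacentDyadicSystem ρ K₀ μ) (p : ℝ) (τ : Fin D.N) (k : ℤ) (α : D.I τ k)
    (t : ℝ) : Set (X × ℝ) :=
  D.Q τ k α ×ˢ Ioo (t - D.δ ^ ((k : ℝ) * p)) (t + D.δ ^ ((k : ℝ) * p))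

/-- `P⁺(τ,k,α,t,γ) = Q τ k α × (t + γ δ^{kp}, t + δ^{kp})`. -/
def rectPlus (D : AdjacentDyadicSystem ρ K₀ μ) (p γ : ℝ) (τ : Fin D.N) (k : ℤ) (α : D.I τ k)
    (t : ℝ) : Set (X × ℝ) :=
  D.Q τ k α ×ˢ Ioo (t + γ * D.δ ^ ((k : ℝ) * p)) (t + D.δ ^ ((k : ℝ) * p))

/-- The parabolic maximal function related to parabolic rectangles, with values in `[0,∞]`: the
supremum, over all rectangles `P(τ,k,α,t)` containing `(x,t)` (with this same `t`), of the average
of `|f|` over `P⁺(τ,k,α,t,γ)`. -/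
noncomputable def maximalPlus (D : AdjacentDyadicSystem ρ K₀ μ) (p γ : ℝ) (f : X × ℝ → ℂ)
    (y : X × ℝ) : ℝ≥0∞ :=
  ⨆ (τ : Fin D.N) (k : ℤ) (α : D.I τ k) (_ : y ∈ D.rect p τ k α y.2),
    ⨍⁻ w in D.rectPlus p γ τ k α y.2, ‖f w‖ₑ ∂(spaceTime μ)

end AdjacentDyadicSystem

/-- The norm `(∫ |f|^q ω)^{1/q}` of the weighted Lebesgue space `L^q(X × ℝ, ω)`. -/
noncomputable def weightedNorm {X : Type*} [MeasurableSpace X] (μ : Measure X) (q : ℝ)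
    (ω : X × ℝ → ℝ) (f : X × ℝ → ℂ) : ℝ≥0∞ :=
  (∫⁻ y, ‖f y‖ₑ ^ q * ENNReal.ofReal (ω y) ∂(spaceTime μ)) ^ (1 / q)

/-- The quasi-norm `sup_{ξ > 0} ξ ω({g > ξ})^{1/q}` of the weighted weak Lebesgue space
`L^{q,∞}(X × ℝ, ω)`, for a function `g` with values in `[0,∞]`. -/
noncomputable def weakNorm {X : Type*} [MeasurableSpace X] (μ : Measure X) (q : ℝ)
    (ω : X × ℝ → ℝ) (g : X × ℝ → ℝ≥0∞) : ℝ≥0∞ :=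
  ⨆ (ξ : ℝ) (_ : 0 < ξ), ENNReal.ofReal ξ *
    (∫⁻ y in {y | ENNReal.ofReal ξ < g y}, ENNReal.ofReal (ω y) ∂(spaceTime μ)) ^ (1 / q)

/-- The parabolic maximal operator with time lag `γ` is bounded from `L^q(X × ℝ, ω)` to
`L^{q,∞}(X × ℝ, ω)`. -/
def MaximalPlusWeakBounded {X : Type*} [MeasurableSpace X] {ρ : X → X → ℝ} {K₀ : ℝ}
    {μ : Measure X} (D : AdjacentDyadicSystem ρ K₀ μ) (p q γ : ℝ) (ω : X × ℝ → ℝ) : Prop :=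
  ∃ C : ℝ≥0, ∀ f : X × ℝ → ℂ, AEMeasurable f (spaceTime μ) → weightedNorm μ q ω f < ∞ →
    AEMeasurable (D.maximalPlus p γ f) (spaceTime μ) ∧
      weakNorm μ q ω (D.maximalPlus p γ f) ≤ (C : ℝ≥0∞) * weightedNorm μ q ω f

section QuasiMetric

variable {X : Type*} {ρ : X → X → ℝ} {K₀ : ℝ}

theorem qBall_subset_qBall {x : X} {r s : ℝ} (h : r ≤ s) : qBall ρ x r ⊆ qBall ρ x s :=
  fun _ hy => lt_of_lt_of_le hy h

theorem IsQuasiMetric.self_eq_zero (h : IsQuasiMetric ρ K₀) (x : X) : ρ x x = 0 :=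
  (h.eq_zero_iff x x).2 rfl

theorem IsQuasiMetric.mem_qBall_self (h : IsQuasiMetric ρ K₀) {x : X} {r : ℝ} (hr : 0 < r) :
    x ∈ qBall ρ x r := by
  simpa [qBall, h.self_eq_zero] using hr

theorem IsQuasiMetric.qBall_subset (h : IsQuasiMetric ρ K₀) {x y : X} {d r : ℝ}
    (hxy : ρ x y ≤ d) : qBall ρ y r ⊆ qBall ρ x (K₀ * (d + r)) := by
  intro z hz
  have h1 := h.quasi_triangle x z y
  have hz' : ρ y z < r := hz
  have hK := h.one_le_const
  calc ρ x z ≤ K₀ * (ρ x y + ρ y z) := h1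
    _ < K₀ * (d + r) :=
      mul_lt_mul_of_pos_left (add_lt_add_of_le_of_lt hxy hz') (by linarith)

/-- In a space with the monotone geodesic property, unboundedness gives points at any prescribed
scale around every point. -/
theorem exists_point_at_scale (h : IsQuasiMetric ρ K₀) (hu : ∀ M : ℝ, ∃ x y : X, M < ρ x y)
    {K : ℝ} (hK : ∀ (s : ℝ), 0 < s → ∀ x y : X, s ≤ ρ x y →
      ∃ (m : ℕ) (u : ℕ → X), 1 ≤ m ∧ u 0 = x ∧ u m = y ∧
        ∀ i < m, ρ (u i) (u (i + 1)) ≤ K * s ∧ ρ (u (i + 1)) (u m) ≤ ρ (u i) (u m) - s)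
    (x : X) {s : ℝ} (hs : 0 < s) : ∃ w : X, s ≤ ρ x w ∧ ρ x w ≤ K * s := by
  have hK0 := h.one_le_const
  obtain ⟨y, hy⟩ : ∃ y, s ≤ ρ y x := by
    obtain ⟨a, b, hab⟩ := hu (K₀ * (s + s))
    by_contra! hcon
    have h1 := hcon a
    have h2 := hcon b
    have h3 := h.quasi_triangle a b x
    rw [h.symm b x] at h2
    have : K₀ * (ρ a x + ρ x b) ≤ K₀ * (s + s) := by gcongr
    linarith
  obtain ⟨m, u, hm, -, hum, hstep⟩ := hK s hs y x hy
  obtain ⟨n, rfl⟩ : ∃ n, m = n + 1 := ⟨m - 1, by omega⟩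
  have h1 := hstep n (by omega)
  rw [hum, h.self_eq_zero] at h1
  refine ⟨u n, ?_, ?_⟩ <;> rw [h.symm x] <;> linarith [h1.1, h1.2]

end QuasiMetric

namespace IsHomogeneousType

variable {X : Type*} [TopologicalSpace X] [MeasurableSpace X] {ρ : X → X → ℝ} {K₀ : ℝ}
  {μ : Measure X}

theorem measurableSet_qBall (hX : IsHomogeneousType ρ K₀ μ) (x : X) (r : ℝ) :
    MeasurableSet (qBall ρ x r) := by
  rcases lt_or_ge 0 r with hr | hr
  · exact hX.measurable_of_isOpen _ (hX.isOpen_ball x r hr)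
  · have : qBall ρ x r = ∅ := by
      ext y
      simp only [qBall, mem_ofPred_eq, mem_empty_iff_false, iff_false, not_lt]
      exact hr.trans (hX.quasiMetric.nonneg x y)
    rw [this]
    exact MeasurableSet.empty

theorem nonempty (hX : IsHomogeneousType ρ K₀ μ) : Nonempty X :=
  let ⟨x, _⟩ := hX.unbounded 0
  ⟨x⟩

theorem sigmaFinite (hX : IsHomogeneousType ρ K₀ μ) : SigmaFinite μ := by
  obtain ⟨x⟩ := hX.nonempty
  refine ⟨⟨⟨fun n => qBall ρ x (n + 1), fun _ => trivial,
    fun n => hX.ball_lt_top x _ (by positivity), ?_⟩⟩⟩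
  refine eq_univ_of_forall fun y => mem_iUnion.2 ?_
  obtain ⟨n, hn⟩ := exists_nat_gt (ρ x y)
  exact ⟨n, show ρ x y < n + 1 by linarith⟩

theorem exists_measure_qBall_mul_le (hX : IsHomogeneousType ρ K₀ μ) (a : ℝ) :
    ∃ C : ℝ≥0, ∀ (x : X) (r : ℝ), 0 < r →
      μ (qBall ρ x (a * r)) ≤ (C : ℝ≥0∞) * μ (qBall ρ x r) := by
  obtain ⟨C, -, hC⟩ := hX.doubling
  have key : ∀ n : ℕ, ∀ (x : X) (r : ℝ), 0 < r →
      μ (qBall ρ x (2 ^ n * r)) ≤ ((C ^ n : ℝ≥0) : ℝ≥0∞) * μ (qBall ρ x r) := by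
    intro n
    induction n with
    | zero => intro x r _; simp
    | succ n ih =>
      intro x r hr
      calc μ (qBall ρ x (2 ^ (n + 1) * r)) = μ (qBall ρ x (2 * (2 ^ n * r))) := by
            congr 2; ring
        _ ≤ C * μ (qBall ρ x (2 ^ n * r)) := hC x _ (by positivity)
        _ ≤ C * (((C ^ n : ℝ≥0) : ℝ≥0∞) * μ (qBall ρ x r)) := by gcongr; exact ih x r hr
        _ = ((C ^ (n + 1) : ℝ≥0) : ℝ≥0∞) * μ (qBall ρ x r) := by
            push_cast; ring
  obtain ⟨n, hn⟩ := pow_unbounded_of_one_lt a (one_lt_two)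
  exact ⟨C ^ n, fun x r hr => (measure_mono (qBall_subset_qBall (by gcongr))).trans (key n x r hr)⟩

theorem exists_measure_qBall_le_of_dist_le (hX : IsHomogeneousType ρ K₀ μ) (d a : ℝ) :
    ∃ C : ℝ≥0, ∀ (x y : X) (r : ℝ), 0 < r → ρ x y ≤ d * r →
      μ (qBall ρ y (a * r)) ≤ (C : ℝ≥0∞) * μ (qBall ρ x r) := by
  obtain ⟨C, hC⟩ := hX.exists_measure_qBall_mul_le (K₀ * (d + a))
  refine ⟨C, fun x y r hr hxy => (measure_mono ?_).trans (hC x r hr)⟩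
  refine (hX.quasiMetric.qBall_subset hxy).trans (qBall_subset_qBall (le_of_eq ?_))
  ring

/-- A ball of radius `m l` is covered by a bounded number of balls of radius `l`. -/
theorem exists_cover_qBall (hX : IsHomogeneousType ρ K₀ μ) (m : ℝ) :
    ∃ n : ℕ, ∀ (x : X) (l : ℝ), 0 < l → ∃ Y : Finset X, Y.card ≤ n ∧
      (∀ y ∈ Y, ρ x y < m * l) ∧ ∀ z ∈ qBall ρ x (m * l), ∃ y ∈ Y, ρ y z < l := by
  classical
  have hK := hX.quasiMetric.one_le_const
  have hq := hX.quasiMetric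
  set b : ℝ := 1 / (2 * K₀) with hb
  have hb0 : 0 < b := by positivity
  set R : ℝ := K₀ * (m + 1) with hR
  obtain ⟨C, hC⟩ := hX.exists_measure_qBall_le_of_dist_le (m / b) (R / b)
  refine ⟨⌈(C : ℝ)⌉₊, fun x l hl => ?_⟩
  let good : Finset X → Prop := fun Y => (∀ y ∈ Y, ρ x y < m * l) ∧
    ∀ y ∈ Y, ∀ z ∈ Y, y ≠ z → l ≤ ρ y z
  have hcard : ∀ Y, good Y → Y.card ≤ ⌈(C : ℝ)⌉₊ := by
    rintro Y ⟨hY1, hY2⟩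
    rcases Y.eq_empty_or_nonempty with rfl | ⟨y₀, hy₀⟩
    · simp
    have hm : 0 < m * l := (hq.nonneg _ _).trans_lt (hY1 y₀ hy₀)
    have hm' : 0 < m := pos_of_mul_pos_left hm hl.le
    have hRl : 0 < R * l := by positivity
    have hbl : 0 < b * l := by positivity
    have h1 : ∑ y ∈ Y, μ (qBall ρ y (b * l)) ≤ μ (qBall ρ x (R * l)) := by
      rw [← measure_biUnion_finset]
      · refine measure_mono (iUnion₂_subset fun y hy => ?_)
        refine (hq.qBall_subset (hY1 y hy).le).trans (qBall_subset_qBall ?_)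
        have : b ≤ 1 := by rw [hb, div_le_one (by positivity)]; linarith
        rw [hR, mul_assoc]
        gcongr
        nlinarith
      · intro y hy z hz hyz
        refine Set.disjoint_left.2 fun w hw1 hw2 => ?_
        have h3 := hY2 y hy z hz hyz
        have h4 := hq.quasi_triangle y z w
        have h5 : ρ y w < b * l := hw1
        have h6 : ρ z w < b * l := hw2
        rw [hq.symm z w] at h6
        have : K₀ * (ρ y w + ρ w z) < K₀ * (b * l + b * l) := by gcongr
        have h7 : K₀ * (b * l + b * l) = l := by rw [hb]; field_simp; norm_num
        linarith
      · exact fun y _ => hX.measurableSet_qBall _ _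
    have h2 : ∀ y ∈ Y, μ (qBall ρ x (R * l)) ≤ C * μ (qBall ρ y (b * l)) := by
      intro y hy
      have := hC y x (b * l) hbl (by
        rw [hq.symm]; calc ρ x y ≤ m * l := (hY1 y hy).le
          _ = m / b * (b * l) := by field_simp)
      rwa [show R / b * (b * l) = R * l by field_simp] at this
    have h3 : (Y.card : ℝ≥0∞) * μ (qBall ρ x (R * l)) ≤ C * μ (qBall ρ x (R * l)) := by
      calc (Y.card : ℝ≥0∞) * μ (qBall ρ x (R * l)) = ∑ y ∈ Y, μ (qBall ρ x (R * l)) := by simp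
        _ ≤ ∑ y ∈ Y, C * μ (qBall ρ y (b * l)) := Finset.sum_le_sum h2
        _ = C * ∑ y ∈ Y, μ (qBall ρ y (b * l)) := by rw [Finset.mul_sum]
        _ ≤ _ := by gcongr
    rw [ENNReal.mul_le_mul_iff_left (hX.ball_pos x _ hRl).ne' (hX.ball_lt_top x _ hRl).ne] at h3
    have h4 : (Y.card : ℝ) ≤ C := by exact_mod_cast h3
    exact_mod_cast h4.trans (Nat.le_ceil _)
  have hne : {c | ∃ Y, good Y ∧ Y.card = c}.Nonempty := ⟨0, ∅, by simp [good], rfl⟩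
  have hbdd : BddAbove {c | ∃ Y, good Y ∧ Y.card = c} :=
    ⟨_, by rintro _ ⟨Y, hY, rfl⟩; exact hcard Y hY⟩
  obtain ⟨Y, hY, hmax⟩ := Nat.sSup_mem hne hbdd
  refine ⟨Y, hcard Y hY, hY.1, fun z hz => ?_⟩
  by_contra! hcon
  have hzY : z ∉ Y := fun hzY => by
    have := hcon z hzY
    rw [hq.self_eq_zero] at this
    linarith
  have hgood : good (insert z Y) := by
    refine ⟨?_, ?_⟩
    · intro y hy
      rcases Finset.mem_insert.1 hy with rfl | hy
      · exact hz
      · exact hY.1 y hy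
    · intro y hy w hw hyw
      rcases Finset.mem_insert.1 hy with hy' | hy' <;>
        rcases Finset.mem_insert.1 hw with hw' | hw'
      · exact absurd (hy'.trans hw'.symm) hyw
      · rw [hy', hq.symm]; exact hcon w hw'
      · rw [hw']; exact hcon y hy'
      · exact hY.2 y hy' w hw' hyw
  have := le_csSup hbdd ⟨_, hgood, rfl⟩
  rw [← hmax, Finset.card_insert_of_notMem hzY] at this
  omega

end IsHomogeneousType

section WeightedHolder

variable {α : Type*} [MeasurableSpace α] {ν : Measure α}

/-- Hölder's inequality `(∫ h)^q ≤ (∫ h^q ω) (∫ ω^{1-q'})^{q-1}` for a weight `ω`. -/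
theorem setLIntegral_rpow_le_weighted {q : ℝ} (hq : 1 < q) {ω : α → ℝ} (hω : AEMeasurable ω ν)
    (hpos : ∀ᵐ y ∂ν, 0 < ω y) {h : α → ℝ≥0∞} (hh : AEMeasurable h ν) (R : Set α) :
    (∫⁻ y in R, h y ∂ν) ^ q ≤ (∫⁻ y in R, h y ^ q * ENNReal.ofReal (ω y) ∂ν) *
      (∫⁻ y in R, ENNReal.ofReal (ω y ^ (1 - Real.conjExponent q)) ∂ν) ^ (q - 1) := by
  have hq0 : 0 < q := by linarith
  have hq1 : 0 < q - 1 := by linarith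
  have hconj : q.HolderConjugate (Real.conjExponent q) := Real.HolderConjugate.conjExponent hq
  have hH := ENNReal.lintegral_mul_le_Lp_mul_Lq (ν.restrict R) hconj
    (f := fun y => h y * ENNReal.ofReal (ω y) ^ (1 / q))
    (g := fun y => ENNReal.ofReal (ω y) ^ (-(1 / q)))
    (hh.restrict.mul (hω.restrict.ennreal_ofReal.pow_const _))
    (hω.restrict.ennreal_ofReal.pow_const _)
  have hposR : ∀ᵐ y ∂(ν.restrict R), 0 < ω y := ae_restrict_of_ae hpos
  have e1 : ∫⁻ y in R, ((fun y => h y * ENNReal.ofReal (ω y) ^ (1 / q)) *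
      fun y => ENNReal.ofReal (ω y) ^ (-(1 / q))) y ∂ν = ∫⁻ y in R, h y ∂ν := by
    refine lintegral_congr_ae ?_
    filter_upwards [hposR] with y hy
    have h0 : ENNReal.ofReal (ω y) ≠ 0 := (ENNReal.ofReal_pos.2 hy).ne'
    simp only [Pi.mul_apply]
    rw [mul_assoc, ← ENNReal.rpow_add _ _ h0 ENNReal.ofReal_ne_top]
    simp
  have e2 : ∫⁻ y in R, (h y * ENNReal.ofReal (ω y) ^ (1 / q)) ^ q ∂ν
      = ∫⁻ y in R, h y ^ q * ENNReal.ofReal (ω y) ∂ν := by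
    refine lintegral_congr fun y => ?_
    rw [ENNReal.mul_rpow_of_nonneg _ _ hq0.le, ← ENNReal.rpow_mul, one_div_mul_cancel hq0.ne',
      ENNReal.rpow_one]
  have hce : Real.conjExponent q = q / (q - 1) := rfl
  have e3 : ∫⁻ y in R, (ENNReal.ofReal (ω y) ^ (-(1 / q))) ^ Real.conjExponent q ∂ν
      = ∫⁻ y in R, ENNReal.ofReal (ω y ^ (1 - Real.conjExponent q)) ∂ν := by
    refine lintegral_congr_ae ?_
    filter_upwards [hposR] with y hy
    rw [← ENNReal.rpow_mul, ENNReal.ofReal_rpow_of_pos hy]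
    congr 2
    rw [hce]; field_simp; ring
  rw [e1, e2, e3] at hH
  calc (∫⁻ y in R, h y ∂ν) ^ q ≤ _ := ENNReal.rpow_le_rpow hH hq0.le
    _ = _ := by
      rw [ENNReal.mul_rpow_of_nonneg _ _ hq0.le, ← ENNReal.rpow_mul, ← ENNReal.rpow_mul,
        one_div_mul_cancel hq0.ne', ENNReal.rpow_one]
      congr 2
      rw [hce]; field_simp

/-- The inequality `ν(S)^q ≤ ω(S) σ(S)^{q-1}` with `σ = ω^{1-q'}`. -/
theorem measure_rpow_le_weighted [SFinite ν] {q : ℝ} (hq : 1 < q) {ω : α → ℝ}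
    (hω : AEMeasurable ω ν) (hpos : ∀ᵐ y ∂ν, 0 < ω y) (S : Set α) :
    ν S ^ q ≤ ν.withDensity (fun y => ENNReal.ofReal (ω y)) S *
      (ν.withDensity (fun y => ENNReal.ofReal (ω y ^ (1 - Real.conjExponent q))) S) ^ (q - 1) := by
  have := setLIntegral_rpow_le_weighted hq hω hpos (h := fun _ => 1) aemeasurable_const S
  simpa [withDensity_apply'] using this

end WeightedHolder

section Selection

/-- A bounded set closed under suprema is covered by finitely many intervals `(a - L, a]` with
`L`-separated right endpoints in the set. -/
theorem exists_finset_cover_Ioc {L : ℝ} (hL : 0 < L) {T : Set ℝ} (hbelow : BddBelow T)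
    (habove : BddAbove T) (hsup : ∀ A ⊆ T, A.Nonempty → sSup A ∈ T) :
    ∃ A : Finset ℝ, ↑A ⊆ T ∧ (∀ t ∈ T, ∃ a ∈ A, t ∈ Ioc (a - L) a) ∧
      ∀ a ∈ A, ∀ b ∈ A, b < a → b ≤ a - L := by
  classical
  obtain ⟨m, hm⟩ := hbelow
  obtain ⟨M, hM⟩ := habove
  obtain ⟨n, hn⟩ := exists_nat_gt ((M - m) / L)
  have hlt : ∀ t ∈ T, t < m + n * L := fun t ht => by
    have := hM ht
    rw [div_lt_iff₀ hL] at hn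
    linarith
  clear hn hM M
  induction n generalizing T with
  | zero =>
    refine ⟨∅, by simp, fun t ht => ?_, by simp⟩
    have h1 := hlt t ht
    have h2 := hm ht
    simp at h1
    linarith
  | succ n ih =>
    rcases T.eq_empty_or_nonempty with rfl | hne
    · exact ⟨∅, by simp, by simp, by simp⟩
    have hbdd : BddAbove T := ⟨_, fun t ht => (hlt t ht).le⟩
    set a := sSup T
    have ha : a ∈ T := hsup T Subset.rfl hne
    have hle : ∀ t ∈ T, t ≤ a := fun t ht => le_csSup hbdd ht
    obtain ⟨A, hA1, hA2, hA3⟩ := ih (T := T \ Ioc (a - L) a) (fun A hA hAne => by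
        refine ⟨hsup A (hA.trans sdiff_subset) hAne, fun hmem => ?_⟩
        obtain ⟨t, ht, htl⟩ := exists_lt_of_lt_csSup hAne hmem.1
        exact (hA ht).2 ⟨htl, hle t (hA ht).1⟩) (fun t ht => hm ht.1) (fun t ht => by
        have h1 : t ≤ a - L := by
          by_contra! hcon
          exact ht.2 ⟨hcon, hle t ht.1⟩
        have h2 := hlt a ha
        push_cast at h2
        linarith)
    refine ⟨insert a A, ?_, ?_, ?_⟩
    · intro t ht
      rcases Finset.mem_insert.1 (Finset.mem_coe.1 ht) with rfl | ht
      · exact ha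
      · exact (hA1 ht).1
    · intro t ht
      by_cases h : t ∈ Ioc (a - L) a
      · exact ⟨a, Finset.mem_insert_self _ _, h⟩
      · obtain ⟨b, hb, htb⟩ := hA2 t ⟨ht, h⟩
        exact ⟨b, Finset.mem_insert_of_mem hb, htb⟩
    · intro b hb c hc hcb
      rcases Finset.mem_insert.1 hb with hb' | hb' <;> rcases Finset.mem_insert.1 hc with hc' | hc'
      · rw [hb', hc'] at hcb; exact absurd hcb (lt_irrefl _)
      · by_contra! hcon
        exact (hA1 hc').2 ⟨by rw [← hb']; exact hcon, by rw [← hb']; exact hcb.le⟩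
      · have := hle b (hA1 hb').1
        rw [hc'] at hcb
        linarith
      · exact hA3 b hb' c hc' hcb

/-- Selection of stopping times `t` for a finite nested family of sets `Q i` of side length `L i`:
larger sets have priority, and every set covers the interval `(t - L i, t]`. -/
theorem exists_stopping_selection {ι X : Type*} (F : Finset ι) (Q : ι → Set X) (L : ι → ℝ)
    (hL : ∀ i ∈ F, 0 < L i)
    (hnest : ∀ i ∈ F, ∀ j ∈ F, L j < L i → Q j ⊆ Q i ∨ Disjoint (Q j) (Q i))
    (hdisj : ∀ i ∈ F, ∀ j ∈ F, i ≠ j → L i = L j → Disjoint (Q i) (Q j))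
    (T : ι → Set ℝ) (hbelow : ∀ i, BddBelow (T i)) (habove : ∀ i, BddAbove (T i))
    (hsup : ∀ i ∈ F, ∀ A ⊆ T i, A.Nonempty → sSup A ∈ T i) :
    ∃ S : Finset (ι × ℝ), (∀ s ∈ S, s.1 ∈ F ∧ s.2 ∈ T s.1) ∧
      (∀ i ∈ F, ∀ t ∈ T i, ∃ s ∈ S, Q i ⊆ Q s.1 ∧ t ∈ Ioc (s.2 - L s.1) s.2) ∧
      ∀ s ∈ S, ∀ s' ∈ S, s ≠ s' → L s'.1 ≤ L s.1 →
        Disjoint (Q s'.1) (Q s.1) ∨ s'.2 ∉ Ioc (s.2 - L s.1) s.2 := by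
  classical
  induction F using Finset.induction_on_min_value L with
  | empty => exact ⟨∅, by simp, by simp, by simp⟩
  | insert i F hi hmin ih =>
    obtain ⟨S, hS1, hS2, hS3⟩ := ih (fun j hj => hL j (Finset.mem_insert_of_mem hj))
      (fun j hj k hk => hnest j (Finset.mem_insert_of_mem hj) k (Finset.mem_insert_of_mem hk))
      (fun j hj k hk => hdisj j (Finset.mem_insert_of_mem hj) k (Finset.mem_insert_of_mem hk))
      (fun j hj => hsup j (Finset.mem_insert_of_mem hj))
    have hiF := Finset.mem_insert_self i F
    set T' : Set ℝ := {t ∈ T i | ∀ s ∈ S, Q i ⊆ Q s.1 → t ∉ Ioc (s.2 - L s.1) s.2} with hT'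
    have hT'T : T' ⊆ T i := fun t ht => ht.1
    obtain ⟨A, hA1, hA2, hA3⟩ := exists_finset_cover_Ioc (hL i hiF) (T := T')
      ((hbelow i).mono hT'T) ((habove i).mono hT'T) (fun B hB hBne => by
        refine ⟨hsup i hiF B (hB.trans hT'T) hBne, fun s hs hQ hmem => ?_⟩
        obtain ⟨t, ht, htl⟩ := exists_lt_of_lt_csSup hBne hmem.1
        exact (hB ht).2 s hs hQ
          ⟨htl, (le_csSup ((habove i).mono (hB.trans hT'T)) ht).trans hmem.2⟩)
    refine ⟨S ∪ A.image (fun a => (i, a)), ?_, ?_, ?_⟩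
    · intro s hs
      rcases Finset.mem_union.1 hs with hs | hs
      · exact ⟨Finset.mem_insert_of_mem (hS1 s hs).1, (hS1 s hs).2⟩
      · obtain ⟨a, ha, rfl⟩ := Finset.mem_image.1 hs
        exact ⟨hiF, (hA1 ha).1⟩
    · intro j hj t ht
      rcases Finset.mem_insert.1 hj with rfl | hj
      · by_cases h : t ∈ T'
        · obtain ⟨a, ha, hta⟩ := hA2 t h
          exact ⟨(j, a), Finset.mem_union_right _ (Finset.mem_image_of_mem _ ha), Subset.rfl, hta⟩
        · have : ∃ s ∈ S, Q j ⊆ Q s.1 ∧ t ∈ Ioc (s.2 - L s.1) s.2 := by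
            by_contra! hcon
            exact h ⟨ht, hcon⟩
          obtain ⟨s, hs, h⟩ := this
          exact ⟨s, Finset.mem_union_left _ hs, h⟩
      · obtain ⟨s, hs, h⟩ := hS2 j hj t ht
        exact ⟨s, Finset.mem_union_left _ hs, h⟩
    · intro s hs s' hs' hne hle
      rcases Finset.mem_union.1 hs with h | h <;> rcases Finset.mem_union.1 hs' with h' | h'
      · exact hS3 s h s' h' hne hle
      · obtain ⟨a, ha, rfl⟩ := Finset.mem_image.1 h'
        have hsF := (hS1 s h).1
        have hine : s.1 ≠ i := fun heq => hi (heq ▸ hsF)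
        rcases hle.lt_or_eq with hlt | heq
        · rcases hnest s.1 (Finset.mem_insert_of_mem hsF) i hiF hlt with hsub | hd
          · exact Or.inr ((hA1 ha).2 s h hsub)
          · exact Or.inl hd
        · exact Or.inl (hdisj i hiF s.1 (Finset.mem_insert_of_mem hsF) hine.symm heq)
      · obtain ⟨a, ha, rfl⟩ := Finset.mem_image.1 h
        have hsF := (hS1 s' h').1
        have hine : s'.1 ≠ i := fun heq => hi (heq ▸ hsF)
        exact Or.inl (hdisj _ (Finset.mem_insert_of_mem hsF) i hiF hine
          (le_antisymm hle (hmin _ hsF)))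
      · obtain ⟨a, ha, rfl⟩ := Finset.mem_image.1 h
        obtain ⟨b, hb, rfl⟩ := Finset.mem_image.1 h'
        right
        rintro ⟨h1, h2⟩
        simp only at h1 h2
        have hba : b < a := lt_of_le_of_ne h2 fun hba => hne (by rw [hba])
        linarith [hA3 a ha b hb hba]

/-- If every set of a finite family carries the mass `2 c i` of `f` and the sets that precede a
given one and meet it are packed, then disjoint portions of (a multiple of) `f` of mass `c i` can
be allocated to the sets. -/
theorem exists_allocation {ι α : Type*} [MeasurableSpace α] {ν : Measure α} (S : Finset ι)
    (L : ι → ℝ) (R : ι → Set α) (c : ι → ℝ≥0∞) {f : α → ℝ≥0∞} (hf : AEMeasurable f ν)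
    (hR : ∀ i ∈ S, NullMeasurableSet (R i) ν) {P : ℝ≥0∞} (hP0 : P ≠ 0) (hPt : P ≠ ∞)
    (hc0 : ∀ i ∈ S, c i ≠ 0) (hc : ∀ i ∈ S, 2 * c i ≤ ∫⁻ y in R i, f y ∂ν)
    (hfin : ∀ i ∈ S, ∫⁻ y in R i, f y ∂ν ≠ ∞)
    (hpack : ∀ i ∈ S, ∀ s ⊆ S, (∀ j ∈ s, j ≠ i ∧ L j ≤ L i ∧ (R j ∩ R i).Nonempty) →
      ∑ j ∈ s, c j ≤ P * c i) :
    ∃ h : ι → α → ℝ≥0∞, (∀ i ∈ S, AEMeasurable (h i) ν ∧ (∀ y, y ∉ R i → h i y = 0) ∧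
      ∫⁻ y, h i y ∂ν = c i) ∧ ∀ y, ∑ i ∈ S, h i y ≤ (P + 1) * f y := by
  classical
  suffices H : ∀ s : Finset ι, s ⊆ S → ∃ h : ι → α → ℝ≥0∞,
      (∀ i ∈ s, AEMeasurable (h i) ν ∧ (∀ y, y ∉ R i → h i y = 0) ∧
        ∫⁻ y, h i y ∂ν = c i) ∧ ∀ y, ∑ i ∈ s, h i y ≤ (P + 1) * f y from H S Subset.rfl
  intro s
  induction s using Finset.induction_on_max_value L with
  | empty => exact fun _ => ⟨fun _ _ => 0, by simp, by simp⟩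
  | insert a s ha hmax ih =>
    intro hsS
    have haS : a ∈ S := hsS (Finset.mem_insert_self _ _)
    have hsS' : s ⊆ S := fun i hi => hsS (Finset.mem_insert_of_mem hi)
    obtain ⟨h, hh1, hh2⟩ := ih hsS'
    set H : α → ℝ≥0∞ := fun y => ∑ i ∈ s, h i y with hH
    have hHm : AEMeasurable H ν := Finset.aemeasurable_fun_sum s fun i hi => (hh1 i hi).1
    set G : Set α := {y | H y ≤ P * f y} with hG
    have hGm : NullMeasurableSet G ν := nullMeasurableSet_le hHm (hf.const_mul P)
    have hHR : ∫⁻ y in R a, H y ∂ν ≤ P * c a := by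
      rw [lintegral_finsetSum' s fun i hi => (hh1 i hi).1.restrict]
      have hsplit : ∑ i ∈ s, ∫⁻ y in R a, h i y ∂ν
          = ∑ i ∈ s with (R i ∩ R a).Nonempty, ∫⁻ y in R a, h i y ∂ν := by
        refine (Finset.sum_filter_of_ne fun i hi hne => ?_).symm
        by_contra hemp
        rw [not_nonempty_iff_eq_empty] at hemp
        refine hne ?_
        have : ∫⁻ y in R a, h i y ∂ν = ∫⁻ y in R a, 0 ∂ν := by
          refine lintegral_congr_ae ?_
          refine (ae_restrict_iff'₀ (hR a haS)).2 (Filter.Eventually.of_forall fun y hy => ?_)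
          refine (hh1 i hi).2.1 y fun hyi => ?_
          exact (Set.ext_iff.1 hemp y).1 ⟨hyi, hy⟩
        rw [this, lintegral_zero]
      rw [hsplit]
      calc _ ≤ ∑ i ∈ s with (R i ∩ R a).Nonempty, c i := by
            refine Finset.sum_le_sum fun i hi => ?_
            rw [← (hh1 i (Finset.mem_filter.1 hi).1).2.2]
            exact setLIntegral_le_lintegral _ _
        _ ≤ P * c a := by
            refine hpack a haS _ ((Finset.filter_subset _ _).trans hsS') fun j hj => ?_
            obtain ⟨hj1, hj2⟩ := Finset.mem_filter.1 hj
            exact ⟨fun hja => ha (hja ▸ hj1), hmax j hj1, hj2⟩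
    have hdiff : ∫⁻ y in R a \ G, f y ∂ν ≤ c a := by
      have h1 : P * ∫⁻ y in R a \ G, f y ∂ν ≤ P * c a := by
        rw [← lintegral_const_mul'' _ hf.restrict]
        refine le_trans (b := ∫⁻ y in R a \ G, H y ∂ν) ?_
          ((lintegral_mono_set sdiff_subset).trans hHR)
        refine lintegral_mono_ae ?_
        refine (ae_restrict_iff'₀ ((hR a haS).diff hGm)).2 (Filter.Eventually.of_forall ?_)
        exact fun y hy => (not_le.1 hy.2).le
      rwa [ENNReal.mul_le_mul_iff_right hP0 hPt] at h1
    have hsum : ∫⁻ y in R a ∩ G, f y ∂ν + ∫⁻ y in R a \ G, f y ∂ν = ∫⁻ y in R a, f y ∂ν := by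
      rw [← lintegral_add_measure, Measure.restrict_inter_add_sdiff₀ (R a) hGm]
    set D := ∫⁻ y in R a ∩ G, f y ∂ν with hD
    have hcfin : c a ≠ ∞ := fun htop => by
      have := hc a haS
      rw [htop] at this
      exact hfin a haS (top_le_iff.1 (le_trans (by simp) this))
    have hDc : c a ≤ D := by
      have h1 := hc a haS
      rw [← hsum, two_mul] at h1
      have h2 : c a + c a ≤ D + c a := h1.trans (by gcongr)
      exact (ENNReal.add_le_add_iff_right hcfin).1 h2
    have hD0 : D ≠ 0 := fun h0 => hc0 a haS (le_zero_iff.1 (h0 ▸ hDc))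
    have hDt : D ≠ ∞ := ((lintegral_mono_set inter_subset_left).trans_lt (hfin a haS).lt_top).ne
    have hk : c a / D ≤ 1 := ENNReal.div_le_of_le_mul (by simpa using hDc)
    have hRG : NullMeasurableSet (R a ∩ G) ν := (hR a haS).inter hGm
    refine ⟨Function.update h a fun y => c a / D * (R a ∩ G).indicator f y, ?_, ?_⟩
    · intro i hi
      rcases eq_or_ne i a with rfl | hia
      · simp only [Function.update_self]
        refine ⟨(hf.indicator₀ hRG).const_mul _, fun y hy => ?_, ?_⟩
        · rw [indicator_of_notMem fun hy' => hy hy'.1, mul_zero]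
        · rw [lintegral_const_mul'' _ (hf.indicator₀ hRG), lintegral_indicator₀ hRG]
          exact ENNReal.div_mul_cancel hD0 hDt
      · rw [Function.update_of_ne hia]
        exact hh1 i (Finset.mem_of_mem_insert_of_ne hi hia)
    · intro y
      rw [Finset.sum_insert ha, Function.update_self]
      have : ∑ i ∈ s, Function.update h a (fun y => c a / D * (R a ∩ G).indicator f y) i y
          = H y := Finset.sum_congr rfl fun i hi => by
        rw [Function.update_of_ne (ne_of_mem_of_not_mem hi ha)]
      rw [this]
      by_cases hy : y ∈ R a ∩ G
      · rw [indicator_of_mem hy]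
        calc c a / D * f y + H y ≤ 1 * f y + P * f y := by gcongr; exact hy.2
          _ = (P + 1) * f y := by ring
      · rw [indicator_of_notMem hy, mul_zero, zero_add]
        exact hh2 y

end Selection

/-- The measure `ω dλ`. -/
noncomputable def weightMeasure {X : Type*} [MeasurableSpace X] (μ : Measure X)
    (ω : X × ℝ → ℝ) : Measure (X × ℝ) :=
  (spaceTime μ).withDensity fun y => ENNReal.ofReal (ω y)

/-- The measure `ω^{1-q'} dλ`. -/
noncomputable def dualMeasure {X : Type*} [MeasurableSpace X] (μ : Measure X) (q : ℝ)
    (ω : X × ℝ → ℝ) : Measure (X × ℝ) :=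
  (spaceTime μ).withDensity fun y => ENNReal.ofReal (ω y ^ (1 - Real.conjExponent q))

theorem spaceTime_prod {X : Type*} [MeasurableSpace X] (μ : Measure X) [SFinite μ] (A : Set X)
    (I : Set ℝ) : spaceTime μ (A ×ˢ I) = μ A * volume I :=
  Measure.prod_prod A I

theorem weightMeasure_apply {X : Type*} [MeasurableSpace X] (μ : Measure X) [SFinite μ]
    (ω : X × ℝ → ℝ) (S : Set (X × ℝ)) :
    weightMeasure μ ω S = ∫⁻ y in S, ENNReal.ofReal (ω y) ∂(spaceTime μ) := by
  have : SFinite (spaceTime μ) := inferInstanceAs (SFinite (μ.prod volume))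
  exact withDensity_apply' _ _

theorem dualMeasure_apply {X : Type*} [MeasurableSpace X] (μ : Measure X) [SFinite μ] (q : ℝ)
    (ω : X × ℝ → ℝ) (S : Set (X × ℝ)) :
    dualMeasure μ q ω S =
      ∫⁻ y in S, ENNReal.ofReal (ω y ^ (1 - Real.conjExponent q)) ∂(spaceTime μ) := by
  have : SFinite (spaceTime μ) := inferInstanceAs (SFinite (μ.prod volume))
  exact withDensity_apply' _ _

theorem weightMeasure_prod_Ioc {X : Type*} [MeasurableSpace X] (μ : Measure X) [SFinite μ]
    (ω : X × ℝ → ℝ) (A : Set X) (a b : ℝ) :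
    weightMeasure μ ω (A ×ˢ Ioc a b) ≤ weightMeasure μ ω (A ×ˢ Ioo a b) := by
  have h0 : weightMeasure μ ω (A ×ˢ {b}) = 0 := by
    refine withDensity_absolutelyContinuous _ _ ?_
    rw [spaceTime_prod]
    simp
  calc weightMeasure μ ω (A ×ˢ Ioc a b)
      ≤ weightMeasure μ ω (A ×ˢ Ioo a b ∪ A ×ˢ {b}) := by
        refine measure_mono ?_
        rintro ⟨x, t⟩ ⟨hx, ht1, ht2⟩
        rcases ht2.lt_or_eq with h | h
        · exact Or.inl ⟨hx, ht1, h⟩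
        · exact Or.inr ⟨hx, h⟩
    _ ≤ _ := (measure_union_le _ _).trans (by rw [h0, add_zero])

namespace AdjacentDyadicSystem

variable {X : Type*} [MeasurableSpace X] {ρ : X → X → ℝ} {K₀ : ℝ}
  {μ : Measure X}

theorem measure_cube_pos [TopologicalSpace X] (hX : IsHomogeneousType ρ K₀ μ) (D : AdjacentDyadicSystem ρ K₀ μ)
    (τ : Fin D.N) (k : ℤ) (α : D.I τ k) : 0 < μ (D.Q τ k α) := by
  have hK := hX.quasiMetric.one_le_const
  have := D.c₀_pos
  have := zpow_pos D.δ_pos k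
  exact (hX.ball_pos _ _ (by positivity)).trans_le (measure_mono (D.ball_subset τ k α))

theorem measure_cube_lt_top [TopologicalSpace X] (hX : IsHomogeneousType ρ K₀ μ) (D : AdjacentDyadicSystem ρ K₀ μ)
    (τ : Fin D.N) (k : ℤ) (α : D.I τ k) : μ (D.Q τ k α) < ∞ := by
  have hK := hX.quasiMetric.one_le_const
  have := D.c₀_pos.trans_le D.c₀_le
  have := zpow_pos D.δ_pos k
  exact (measure_mono (D.subset_ball τ k α)).trans_lt (hX.ball_lt_top _ _ (by positivity))

theorem two_mul_side_le [TopologicalSpace X] (hX : IsHomogeneousType ρ K₀ μ) (D : AdjacentDyadicSystem ρ K₀ μ)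
    {p : ℝ} (hp : 1 ≤ p) {k l : ℤ} (hkl : k < l) :
    2 * D.δ ^ ((l : ℝ) * p) ≤ D.δ ^ ((k : ℝ) * p) := by
  have hδ0 := D.δ_pos
  have hδ : D.δ ≤ 1 / 2 := by
    have h1 : 1 ≤ K₀ ^ 6 := one_le_pow₀ hX.quasiMetric.one_le_const
    nlinarith [D.δ_small]
  have h2 : ((k : ℝ) * p) + 1 ≤ (l : ℝ) * p := by
    have : (k : ℝ) + 1 ≤ l := by exact_mod_cast hkl
    nlinarith
  have h3 := Real.rpow_le_rpow_of_exponent_ge hδ0 D.δ_lt_one.le h2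
  rw [Real.rpow_add hδ0, Real.rpow_one] at h3
  have := Real.rpow_pos_of_pos hδ0 ((k : ℝ) * p)
  nlinarith

theorem side_lt_side_iff [TopologicalSpace X] (hX : IsHomogeneousType ρ K₀ μ) (D : AdjacentDyadicSystem ρ K₀ μ)
    {p : ℝ} (hp : 1 ≤ p) {k l : ℤ} :
    D.δ ^ ((l : ℝ) * p) < D.δ ^ ((k : ℝ) * p) ↔ k < l := by
  have h : ∀ k l : ℤ, k < l → D.δ ^ ((l : ℝ) * p) < D.δ ^ ((k : ℝ) * p) := fun k l hkl => by
    have h1 := D.two_mul_side_le hX hp hkl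
    have h2 := Real.rpow_pos_of_pos D.δ_pos ((l : ℝ) * p)
    linarith
  refine ⟨fun hlt => ?_, h k l⟩
  by_contra! hcon
  rcases hcon.lt_or_eq with h' | rfl
  · exact absurd (h _ _ h') hlt.not_gt
  · exact lt_irrefl _ hlt

theorem nullMeasurableSet_rectPlus [SFinite μ] (D : AdjacentDyadicSystem ρ K₀ μ) (p γ : ℝ)
    (τ : Fin D.N) (k : ℤ) (α : D.I τ k) (t : ℝ) :
    NullMeasurableSet (D.rectPlus p γ τ k α t) (spaceTime μ) :=
  (D.measurable_cube τ k α).prod measurableSet_Ioo.nullMeasurableSet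

theorem measure_rectPlus [SFinite μ] (D : AdjacentDyadicSystem ρ K₀ μ) (p γ : ℝ)
    (τ : Fin D.N) (k : ℤ) (α : D.I τ k) (t : ℝ) :
    spaceTime μ (D.rectPlus p γ τ k α t) =
      μ (D.Q τ k α) * ENNReal.ofReal ((1 - γ) * D.δ ^ ((k : ℝ) * p)) := by
  rw [rectPlus, spaceTime_prod, Real.volume_Ioo]
  congr 2
  ring

/-- The integral of a bounded function over `P⁺(τ,k,α,t,γ)` is at least `c` on a set of times `t`
that is closed under suprema. -/
theorem sSup_mem_superlevel [SFinite μ] (D : AdjacentDyadicSystem ρ K₀ μ) {p γ : ℝ} {τ : Fin D.N}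
    {k : ℤ} {α : D.I τ k} (hμ : μ (D.Q τ k α) ≠ ∞) {g : X × ℝ → ℝ≥0∞} {B : ℝ≥0}
    (hB : ∀ y, g y ≤ B) {N : ℝ} {c : ℝ≥0∞} {A : Set ℝ}
    (hA : A ⊆ {t ∈ Icc (-N) N | c ≤ ∫⁻ y in D.rectPlus p γ τ k α t, g y ∂(spaceTime μ)})
    (hne : A.Nonempty) :
    sSup A ∈ {t ∈ Icc (-N) N | c ≤ ∫⁻ y in D.rectPlus p γ τ k α t, g y ∂(spaceTime μ)} := by
  have hbdd : BddAbove A := ⟨N, fun t ht => (hA ht).1.2⟩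
  obtain ⟨t₀, ht₀⟩ := hne
  refine ⟨⟨(hA ht₀).1.1.trans (le_csSup hbdd ht₀), csSup_le ⟨t₀, ht₀⟩ fun t ht => (hA ht).1.2⟩, ?_⟩
  refine ENNReal.le_of_forall_pos_le_add fun ε hε _ => ?_
  set s := sSup A
  set M : ℝ≥0 := B * (μ (D.Q τ k α)).toNNReal + 1
  obtain ⟨t, ht, hts⟩ := exists_lt_of_lt_csSup ⟨t₀, ht₀⟩ (show s - ε / M < s by
    have : 0 < (ε : ℝ) / M := by positivity
    linarith)
  have hle : t ≤ s := le_csSup hbdd ht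
  set a := γ * D.δ ^ ((k : ℝ) * p)
  refine (hA ht).2.trans ?_
  calc ∫⁻ y in D.rectPlus p γ τ k α t, g y ∂(spaceTime μ)
      ≤ ∫⁻ y in D.rectPlus p γ τ k α s ∪ D.Q τ k α ×ˢ Ioc (t + a) (s + a), g y ∂(spaceTime μ) := by
        refine lintegral_mono_set ?_
        rintro ⟨x, r⟩ ⟨hx, hr1, hr2⟩
        simp only at hx hr1 hr2
        rcases lt_or_ge (s + a) r with h | h
        · exact Or.inl ⟨hx, h, lt_of_lt_of_le hr2 (by linarith)⟩
        · exact Or.inr ⟨hx, hr1, h⟩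
    _ ≤ ∫⁻ y in D.rectPlus p γ τ k α s, g y ∂(spaceTime μ) +
        ∫⁻ y in D.Q τ k α ×ˢ Ioc (t + a) (s + a), g y ∂(spaceTime μ) := lintegral_union_le _ _ _
    _ ≤ _ := by
        gcongr
        calc ∫⁻ y in D.Q τ k α ×ˢ Ioc (t + a) (s + a), g y ∂(spaceTime μ)
            ≤ ∫⁻ y in D.Q τ k α ×ˢ Ioc (t + a) (s + a), B ∂(spaceTime μ) := lintegral_mono hB
          _ = B * (μ (D.Q τ k α) * ENNReal.ofReal (s - t)) := by
              rw [setLIntegral_const, spaceTime_prod, Real.volume_Ioc]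
              congr 3; ring
          _ ≤ (M : ℝ≥0∞) * ENNReal.ofReal (s - t) := by
              rw [← mul_assoc]
              gcongr
              simp only [M]
              push_cast
              rw [ENNReal.coe_toNNReal hμ]
              exact le_self_add
          _ ≤ (M : ℝ≥0∞) * ENNReal.ofReal (ε / M) := by gcongr; linarith
          _ = ε := by
              rw [← ENNReal.ofReal_coe_nnreal, ← ENNReal.ofReal_mul (by positivity),
                mul_div_cancel₀ _ (by positivity), ENNReal.ofReal_coe_nnreal]

end AdjacentDyadicSystem

/-- Disjointness of the lower halves of the time intervals below two selected stopping times. -/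
theorem disjoint_Ioc_of_selected {t t' L L' : ℝ} (hL' : 0 < L') (h : 2 * L' ≤ L)
    (ht : t' ∉ Ioc (t - L) t) :
    Disjoint (Ioc (t' - L') (t' - L' / 2)) (Ioc (t - L) (t - L / 2)) := by
  refine Set.disjoint_left.2 fun r hr1 hr2 => ht ⟨?_, ?_⟩
  · linarith [hr1.2, hr2.1]
  · by_contra! hcon
    linarith [hr1.1, hr2.2]

theorem sum_rpow_le_rpow_of_sum_le {ι : Type*} (S : Finset ι) {h : ι → ℝ≥0∞} {g : ℝ≥0∞} {q : ℝ}
    (hq : 1 ≤ q) (hsum : ∑ i ∈ S, h i ≤ g) : ∑ i ∈ S, h i ^ q ≤ g ^ q := by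
  have e : ∀ x : ℝ≥0∞, x ^ q = x * x ^ (q - 1) := fun x => by
    conv_lhs => rw [show q = 1 + (q - 1) by ring]
    rw [ENNReal.rpow_add_of_nonneg _ _ zero_le_one (by linarith), ENNReal.rpow_one]
  calc ∑ i ∈ S, h i ^ q ≤ ∑ i ∈ S, h i * g ^ (q - 1) := by
        refine Finset.sum_le_sum fun i hi => ?_
        rw [e]
        exact mul_le_mul' le_rfl (ENNReal.rpow_le_rpow
          ((Finset.single_le_sum (fun _ _ => zero_le) hi).trans hsum) (by linarith))
    _ = (∑ i ∈ S, h i) * g ^ (q - 1) := by rw [Finset.sum_mul]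
    _ ≤ g * g ^ (q - 1) := by gcongr
    _ = g ^ q := (e g).symm

namespace AdjacentDyadicSystem

variable {X : Type*} [MeasurableSpace X] {ρ : X → X → ℝ} {K₀ : ℝ} {μ : Measure X}

/-- The `A_q`-type condition with time lag on the dyadic rectangles, in which the lower part
reaches up to the time `t`. -/
def CubeCondition (D : AdjacentDyadicSystem ρ K₀ μ) (p q γ : ℝ) (ω : X × ℝ → ℝ) (C : ℝ≥0) : Prop :=
  ∀ (τ : Fin D.N) (k : ℤ) (α : D.I τ k) (t : ℝ),
    weightMeasure μ ω (D.Q τ k α ×ˢ Ioo (t - D.δ ^ ((k : ℝ) * p)) t) *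
      dualMeasure μ q ω (D.rectPlus p γ τ k α t) ^ (q - 1) ≤
    C * (μ (D.Q τ k α) * ENNReal.ofReal (D.δ ^ ((k : ℝ) * p))) ^ q

/-- Weak type estimate for finitely many cubes and bounded functions. -/
theorem weak_type_finset [TopologicalSpace X] (hX : IsHomogeneousType ρ K₀ μ)
    (D : AdjacentDyadicSystem ρ K₀ μ) {p q γ : ℝ} (hp : 1 ≤ p) (hq : 1 < q) (hγ0 : 0 ≤ γ)
    (hγ1 : γ < 1) {ω : X × ℝ → ℝ} (hω : IsWeight ρ p μ ω) {C : ℝ≥0}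
    (hC : D.CubeCondition p q γ ω C) (τ : Fin D.N) (F : Finset (Σ k, D.I τ k)) (N : ℝ)
    {g : X × ℝ → ℝ≥0∞} (hg : AEMeasurable g (spaceTime μ)) {B : ℝ≥0} (hB : ∀ y, g y ≤ B)
    {ξ : ℝ≥0∞} (hξ0 : ξ ≠ 0) :
    ENNReal.ofReal ((1 - γ) / 2) ^ q * ξ ^ q *
      weightMeasure μ ω (⋃ i ∈ F, D.Q τ i.1 i.2 ×ˢ {t ∈ Icc (-N) N |
        ξ * spaceTime μ (D.rectPlus p γ τ i.1 i.2 t) ≤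
          ∫⁻ y in D.rectPlus p γ τ i.1 i.2 t, g y ∂(spaceTime μ)}) ≤
    C * 7 ^ q * ∫⁻ y, g y ^ q * ENNReal.ofReal (ω y) ∂(spaceTime μ) := by
  classical
  have := hX.sigmaFinite
  have hq0 : 0 < q := by linarith
  set L : (Σ k, D.I τ k) → ℝ := fun i => D.δ ^ ((i.1 : ℝ) * p) with hLdef
  set Q : (Σ k, D.I τ k) → Set X := fun i => D.Q τ i.1 i.2 with hQdef
  have hL : ∀ i, 0 < L i := fun i => Real.rpow_pos_of_pos D.δ_pos _
  have hQt : ∀ i, μ (Q i) ≠ ∞ := fun i => (D.measure_cube_lt_top hX _ _ _).ne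
  have hQ0 : ∀ i, μ (Q i) ≠ 0 := fun i => (D.measure_cube_pos hX _ _ _).ne'
  have hlt : ∀ i j, L j < L i ↔ i.1 < j.1 := fun i j => D.side_lt_side_iff hX hp
  have hnest : ∀ i j, L j < L i → Q j ⊆ Q i ∨ Disjoint (Q j) (Q i) := fun i j hij =>
    D.nested τ i.1 j.1 ((hlt i j).1 hij).le i.2 j.2
  have hdisj : ∀ i j, i ≠ j → L i = L j → Disjoint (Q i) (Q j) := by
    rintro ⟨k, α⟩ ⟨l, β⟩ hne heq
    have h1 : ¬ k < l := fun h => ((hlt ⟨k, α⟩ ⟨l, β⟩).2 h).ne' heq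
    have h2 : ¬ l < k := fun h => ((hlt ⟨l, β⟩ ⟨k, α⟩).2 h).ne heq
    obtain rfl : k = l := by omega
    exact D.disjoint τ k α β fun h => hne (by rw [h])
  have hhalf : ∀ i j, L j < L i → 2 * L j ≤ L i := fun i j hij =>
    D.two_mul_side_le hX hp ((hlt i j).1 hij)
  set κ : ℝ≥0∞ := ENNReal.ofReal ((1 - γ) / 2) with hκ
  have hκ0 : κ ≠ 0 := (ENNReal.ofReal_pos.2 (by linarith)).ne'
  have hκt : κ ≠ ∞ := ENNReal.ofReal_ne_top
  set T : (Σ k, D.I τ k) → Set ℝ := fun i => {t ∈ Icc (-N) N |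
        ξ * spaceTime μ (D.rectPlus p γ τ i.1 i.2 t) ≤
          ∫⁻ y in D.rectPlus p γ τ i.1 i.2 t, g y ∂(spaceTime μ)} with hT
  have hTsup : ∀ i ∈ F, ∀ A ⊆ T i, A.Nonempty → sSup A ∈ T i := by
    intro i _ A hA hne
    simp only [hT, D.measure_rectPlus] at hA ⊢
    exact D.sSup_mem_superlevel (hQt i) hB hA hne
  obtain ⟨S, hS1, hS2, hS3⟩ := exists_stopping_selection F Q L (fun i _ => hL i)
    (fun i _ j _ => hnest i j) (fun i _ j _ => hdisj i j) T (fun i => ⟨-N, fun t ht => ht.1.1⟩)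
    (fun i => ⟨N, fun t ht => ht.1.2⟩) hTsup
  set R : (Σ k, D.I τ k) × ℝ → Set (X × ℝ) := fun s => D.rectPlus p γ τ s.1.1 s.1.2 s.2 with hR
  have hRmem : ∀ s x r, (x, r) ∈ R s ↔
      x ∈ Q s.1 ∧ s.2 + γ * L s.1 < r ∧ r < s.2 + L s.1 := fun s x r => Iff.rfl
  set V : (Σ k, D.I τ k) × ℝ → ℝ≥0∞ := fun s => μ (Q s.1) * ENNReal.ofReal (L s.1) with hV
  have hV0 : ∀ s, V s ≠ 0 := fun s => mul_ne_zero (hQ0 _) (ENNReal.ofReal_pos.2 (hL _)).ne'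
  have hVt : ∀ s, V s ≠ ∞ := fun s => ENNReal.mul_ne_top (hQt _) ENNReal.ofReal_ne_top
  have hRV : ∀ s, spaceTime μ (R s) = 2 * κ * V s := by
    intro s
    simp only [hR, hV, hκ]
    rw [D.measure_rectPlus, show (1 - γ) * D.δ ^ ((s.1.1 : ℝ) * p) = 2 * ((1 - γ) / 2) * L s.1 by
      simp only [hLdef]; ring, ENNReal.ofReal_mul (by linarith), ENNReal.ofReal_mul (by norm_num)]
    simp only [ENNReal.ofReal_ofNat]
    ring
  -- the lower halves are disjoint
  set H : (Σ k, D.I τ k) × ℝ → Set (X × ℝ) :=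
    fun s => Q s.1 ×ˢ Ioc (s.2 - L s.1) (s.2 - L s.1 / 2) with hH
  have hHV : ∀ s, V s = 2 * spaceTime μ (H s) := by
    intro s
    simp only [hH, hV]
    rw [spaceTime_prod, Real.volume_Ioc, mul_left_comm, ← ENNReal.ofReal_ofNat 2,
      ← ENNReal.ofReal_mul (by norm_num)]
    congr 2
    ring
  have hHm : ∀ s, NullMeasurableSet (H s) (spaceTime μ) := fun s =>
    (D.measurable_cube τ s.1.1 s.1.2).prod measurableSet_Ioc.nullMeasurableSet
  have hHdisj' : ∀ s ∈ S, ∀ s' ∈ S, s ≠ s' → L s'.1 ≤ L s.1 → Disjoint (H s') (H s) := by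
    intro s hs s' hs' hne hle
    rcases hS3 s hs s' hs' hne hle with hd | hnot
    · exact Set.disjoint_prod.2 (Or.inl hd)
    rcases hle.lt_or_eq with h | h
    · exact Set.disjoint_prod.2 (Or.inr (disjoint_Ioc_of_selected (hL _) (hhalf _ _ h) hnot))
    · by_cases hii : s.1 = s'.1
      · rcases hS3 s' hs' s hs hne.symm h.ge with hd | hnot'
        · exact Set.disjoint_prod.2 (Or.inl hd.symm)
        refine Set.disjoint_prod.2 (Or.inr ?_)
        rw [← hii] at hnot' ⊢
        have hLs := hL s.1
        refine Set.disjoint_left.2 fun r hr1 hr2 => ?_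
        rcases le_total s'.2 s.2 with h1 | h1
        · exact hnot ⟨by linarith [hr1.2, hr2.1], h1⟩
        · exact hnot' ⟨by linarith [hr1.1, hr2.2], h1⟩
      · exact Set.disjoint_prod.2 (Or.inl (hdisj _ _ (fun h' => hii h'.symm) h))
  have hHdisj : (S : Set _).Pairwise (Function.onFun (AEDisjoint (spaceTime μ)) H) := by
    intro s hs s' hs' hne
    rcases le_total (L s'.1) (L s.1) with h | h
    · exact (hHdisj' s hs s' hs' hne h).symm.aedisjoint
    · exact (hHdisj' s' hs' s hs hne.symm h).aedisjoint
  -- allocation of the mass of `g`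
  obtain ⟨h, hh1, hh2⟩ := exists_allocation (ν := spaceTime μ) S (fun s => L s.1) R
    (fun s => ξ * κ * V s) hg (fun s _ => D.nullMeasurableSet_rectPlus p γ τ _ _ _)
    (P := 6) (by norm_num) (by norm_num) (fun s _ => mul_ne_zero (mul_ne_zero hξ0 hκ0) (hV0 s))
    (fun s hs => by
      have := (hS1 s hs).2.2
      refine le_trans (le_of_eq ?_) this
      rw [show spaceTime μ (D.rectPlus p γ τ s.1.1 s.1.2 s.2) = 2 * κ * V s from hRV s]
      ring)
    (fun s _ => by
      refine ne_top_of_le_ne_top (ENNReal.mul_ne_top (ENNReal.coe_ne_top (r := B)) ?_)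
        ((lintegral_mono hB).trans_eq (setLIntegral_const _ _))
      rw [hRV]
      exact ENNReal.mul_ne_top (ENNReal.mul_ne_top (by norm_num) hκt) (hVt s))
    (fun s hs S' hS' hmeet => by
      have hsub : ⋃ s' ∈ S', H s' ⊆ Q s.1 ×ˢ Ioc (s.2 - 2 * L s.1) (s.2 + L s.1) := by
        refine iUnion₂_subset fun s' hs' => ?_
        obtain ⟨hne, hle, ⟨x, r⟩, hx', hx⟩ := hmeet s' hs'
        rw [hRmem] at hx hx'
        have hLs' := hL s'.1
        have hLs := hL s.1
        have hγ' : 0 ≤ γ * L s'.1 := mul_nonneg hγ0 hLs'.le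
        have hγ : 0 ≤ γ * L s.1 := mul_nonneg hγ0 hLs.le
        have hQsub : Q s'.1 ⊆ Q s.1 := by
          rcases hle.lt_or_eq with h | h
          · rcases hnest _ _ h with h | h
            · exact h
            · exact absurd hx.1 (Set.disjoint_left.1 h hx'.1)
          · by_cases hii : s'.1 = s.1
            · rw [hii]
            · exact absurd hx.1 (Set.disjoint_left.1 (hdisj _ _ hii h) hx'.1)
        refine prod_mono hQsub (Ioc_subset_Ioc ?_ ?_)
        · linarith [hx.2.1, hx'.2.2]
        · linarith [hx.2.2, hx'.2.1]
      calc ∑ s' ∈ S', ξ * κ * V s' = ξ * κ * 2 * ∑ s' ∈ S', spaceTime μ (H s') := by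
            rw [Finset.mul_sum]
            refine Finset.sum_congr rfl fun s' _ => ?_
            rw [hHV]; ring
        _ = ξ * κ * 2 * spaceTime μ (⋃ s' ∈ S', H s') := by
            rw [measure_biUnion_finset₀ (hHdisj.mono (by exact_mod_cast hS')) fun s' _ => hHm s']
        _ ≤ ξ * κ * 2 * spaceTime μ (Q s.1 ×ˢ Ioc (s.2 - 2 * L s.1) (s.2 + L s.1)) := by
            gcongr
        _ = 6 * (ξ * κ * V s) := by
            rw [spaceTime_prod, Real.volume_Ioc,
              show s.2 + L s.1 - (s.2 - 2 * L s.1) = 3 * L s.1 by ring,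
              ENNReal.ofReal_mul (by norm_num), ENNReal.ofReal_ofNat]
            simp only [hV]
            ring)
  -- the estimate for a single rectangle
  have hone : ∀ s ∈ S, κ ^ q * ξ ^ q * weightMeasure μ ω (Q s.1 ×ˢ Ioo (s.2 - L s.1) s.2) ≤
      C * ∫⁻ y, h s y ^ q * ENNReal.ofReal (ω y) ∂(spaceTime μ) := by
    intro s hs
    obtain ⟨hm, hzero, hint⟩ := hh1 s hs
    have hsupp : ∫⁻ y in R s, h s y ∂(spaceTime μ) = ∫⁻ y, h s y ∂(spaceTime μ) :=
      setLIntegral_eq_of_support_subset fun y hy => by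
        by_contra hcon
        exact hy (hzero y hcon)
    have hHol := setLIntegral_rpow_le_weighted hq hω.aemeasurable hω.pos hm (R s)
    rw [hsupp, hint, ← dualMeasure_apply] at hHol
    have h1 : (∫⁻ y in R s, h s y ^ q * ENNReal.ofReal (ω y) ∂(spaceTime μ)) ≤
      ∫⁻ y, h s y ^ q * ENNReal.ofReal (ω y) ∂(spaceTime μ) := setLIntegral_le_lintegral _ _
    have h2 := hC τ s.1.1 s.1.2 s.2
    have h3 : (κ ^ q * ξ ^ q * weightMeasure μ ω (Q s.1 ×ˢ Ioo (s.2 - L s.1) s.2)) * V s ^ q ≤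
        (C * ∫⁻ y, h s y ^ q * ENNReal.ofReal (ω y) ∂(spaceTime μ)) * V s ^ q := by
      calc _ = weightMeasure μ ω (Q s.1 ×ˢ Ioo (s.2 - L s.1) s.2) * (ξ * κ * V s) ^ q := by
            rw [ENNReal.mul_rpow_of_nonneg (ξ * κ) (V s) hq0.le,
              ENNReal.mul_rpow_of_nonneg ξ κ hq0.le]
            ring
        _ ≤ weightMeasure μ ω (Q s.1 ×ˢ Ioo (s.2 - L s.1) s.2) *
            ((∫⁻ y, h s y ^ q * ENNReal.ofReal (ω y) ∂(spaceTime μ)) *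
              dualMeasure μ q ω (R s) ^ (q - 1)) := by
            gcongr
            exact hHol.trans (by gcongr)
        _ = (weightMeasure μ ω (Q s.1 ×ˢ Ioo (s.2 - L s.1) s.2) *
            dualMeasure μ q ω (R s) ^ (q - 1)) *
            ∫⁻ y, h s y ^ q * ENNReal.ofReal (ω y) ∂(spaceTime μ) := by ring
        _ ≤ (C * V s ^ q) * ∫⁻ y, h s y ^ q * ENNReal.ofReal (ω y) ∂(spaceTime μ) := by
            gcongr
        _ = _ := by ring
    rwa [ENNReal.mul_le_mul_iff_left
      (ENNReal.rpow_pos (pos_iff_ne_zero.2 (hV0 s)) (hVt s)).ne'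
      (ENNReal.rpow_ne_top_of_nonneg hq0.le (hVt s))] at h3
  have hcov : (⋃ i ∈ F, Q i ×ˢ T i) ⊆ ⋃ s ∈ S, Q s.1 ×ˢ Ioc (s.2 - L s.1) s.2 := by
    refine iUnion₂_subset fun i hi => ?_
    rintro ⟨x, t⟩ ⟨hx, ht⟩
    obtain ⟨s, hs, hsub, hts⟩ := hS2 i hi t ht
    exact mem_biUnion hs ⟨hsub hx, hts⟩
  calc κ ^ q * ξ ^ q * weightMeasure μ ω (⋃ i ∈ F, Q i ×ˢ T i)
      ≤ κ ^ q * ξ ^ q * ∑ s ∈ S, weightMeasure μ ω (Q s.1 ×ˢ Ioo (s.2 - L s.1) s.2) := by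
        gcongr
        refine (measure_mono hcov).trans ((measure_biUnion_finset_le _ _).trans ?_)
        exact Finset.sum_le_sum fun s _ => weightMeasure_prod_Ioc μ ω _ _ _
    _ = ∑ s ∈ S, κ ^ q * ξ ^ q * weightMeasure μ ω (Q s.1 ×ˢ Ioo (s.2 - L s.1) s.2) := by
        rw [Finset.mul_sum]
    _ ≤ ∑ s ∈ S, C * ∫⁻ y, h s y ^ q * ENNReal.ofReal (ω y) ∂(spaceTime μ) :=
        Finset.sum_le_sum hone
    _ = C * ∫⁻ y, ∑ s ∈ S, h s y ^ q * ENNReal.ofReal (ω y) ∂(spaceTime μ) := by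
        rw [← Finset.mul_sum, lintegral_finsetSum']
        exact fun s hs => ((hh1 s hs).1.pow_const _).mul hω.aemeasurable.ennreal_ofReal
    _ ≤ C * ∫⁻ y, 7 ^ q * (g y ^ q * ENNReal.ofReal (ω y)) ∂(spaceTime μ) := by
        gcongr with y
        rw [← Finset.sum_mul, ← mul_assoc]
        gcongr
        rw [← ENNReal.mul_rpow_of_nonneg _ _ hq0.le]
        refine sum_rpow_le_rpow_of_sum_le S hq.le ((hh2 y).trans_eq ?_)
        norm_num
    _ = _ := by
        have hm : AEMeasurable (fun y => g y ^ q * ENNReal.ofReal (ω y)) (spaceTime μ) :=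
          (hg.pow_const _).mul hω.aemeasurable.ennreal_ofReal
        rw [lintegral_const_mul'' _ hm, mul_assoc]

end AdjacentDyadicSystem

namespace AdjacentDyadicSystem

variable {X : Type*} [MeasurableSpace X] {ρ : X → X → ℝ} {K₀ : ℝ} {μ : Measure X}

theorem mem_rect_self_iff (D : AdjacentDyadicSystem ρ K₀ μ) (p : ℝ) (τ : Fin D.N) (k : ℤ)
    (α : D.I τ k) (y : X × ℝ) : y ∈ D.rect p τ k α y.2 ↔ y.1 ∈ D.Q τ k α := by
  have := Real.rpow_pos_of_pos D.δ_pos ((k : ℝ) * p)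
  exact ⟨fun h => h.1, fun h => ⟨h, by linarith, by linarith⟩⟩

theorem measurable_setLIntegral_rectPlus [SFinite μ] (D : AdjacentDyadicSystem ρ K₀ μ) (p γ : ℝ)
    (τ : Fin D.N) (k : ℤ) (α : D.I τ k) (g : X × ℝ → ℝ≥0∞) :
    Measurable fun t => ∫⁻ y in D.rectPlus p γ τ k α t, g y ∂(spaceTime μ) := by
  have : SFinite (spaceTime μ) := inferInstanceAs (SFinite (μ.prod volume))
  set m : Measure ℝ :=
    (((spaceTime μ).withDensity g).restrict (D.Q τ k α ×ˢ univ)).map Prod.snd with hm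
  set a := γ * D.δ ^ ((k : ℝ) * p)
  set b := D.δ ^ ((k : ℝ) * p)
  have hS : MeasurableSet {z : ℝ × ℝ | z.1 + a < z.2 ∧ z.2 < z.1 + b} :=
    (measurableSet_lt (measurable_fst.add_const a) measurable_snd).inter
      (measurableSet_lt measurable_snd (measurable_fst.add_const b))
  convert measurable_measure_prodMk_left (ν := m) hS using 1
  funext t
  have hpre : Prod.mk t ⁻¹' {z : ℝ × ℝ | z.1 + a < z.2 ∧ z.2 < z.1 + b} = Ioo (t + a) (t + b) :=
    rfl
  rw [hpre, hm, Measure.map_apply measurable_snd measurableSet_Ioo,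
    Measure.restrict_apply (measurable_snd measurableSet_Ioo), withDensity_apply']
  congr 2
  ext ⟨x, r⟩
  simp [rectPlus, and_comm, a, b]

theorem aemeasurable_maximalPlus [SFinite μ] (D : AdjacentDyadicSystem ρ K₀ μ) (p γ : ℝ)
    (f : X × ℝ → ℂ) : AEMeasurable (D.maximalPlus p γ f) (spaceTime μ) := by
  refine AEMeasurable.iSup fun τ => AEMeasurable.iSup fun k => ?_
  have := D.countable_index τ k
  refine AEMeasurable.iSup fun α => ?_
  have hm : Measurable fun t => ⨍⁻ w in D.rectPlus p γ τ k α t, ‖f w‖ₑ ∂(spaceTime μ) := by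
    simp only [setLAverage_eq, D.measure_rectPlus]
    exact (D.measurable_setLIntegral_rectPlus p γ τ k α _).div_const _
  have hQ : NullMeasurableSet (D.Q τ k α ×ˢ (univ : Set ℝ)) (spaceTime μ) :=
    (D.measurable_cube τ k α).prod MeasurableSet.univ.nullMeasurableSet
  refine ((hm.comp measurable_snd).aemeasurable.indicator₀ hQ).congr
    (Filter.Eventually.of_forall fun y => ?_)
  by_cases hy : y.1 ∈ D.Q τ k α
  · simp only [D.mem_rect_self_iff, hy, iSup_pos]
    exact indicator_of_mem (show y ∈ D.Q τ k α ×ˢ (univ : Set ℝ) from ⟨hy, mem_univ _⟩) _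
  · simp only [D.mem_rect_self_iff, hy, iSup_false]
    rw [indicator_of_notMem fun h => hy h.1]
    rfl

/-- Weak type estimate for one of the dyadic systems. -/
theorem weak_type_system [TopologicalSpace X] (hX : IsHomogeneousType ρ K₀ μ)
    (D : AdjacentDyadicSystem ρ K₀ μ) {p q γ : ℝ} (hp : 1 ≤ p) (hq : 1 < q) (hγ0 : 0 ≤ γ)
    (hγ1 : γ < 1) {ω : X × ℝ → ℝ} (hω : IsWeight ρ p μ ω) {C : ℝ≥0}
    (hC : D.CubeCondition p q γ ω C) (τ : Fin D.N)
    {g : X × ℝ → ℝ≥0∞} (hg : AEMeasurable g (spaceTime μ)) {ξ : ℝ≥0∞} (hξ0 : ξ ≠ 0) :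
    ENNReal.ofReal ((1 - γ) / 2) ^ q * ξ ^ q *
      weightMeasure μ ω {y | ∃ (k : ℤ) (α : D.I τ k), y.1 ∈ D.Q τ k α ∧
        ξ * spaceTime μ (D.rectPlus p γ τ k α y.2) <
          ∫⁻ w in D.rectPlus p γ τ k α y.2, g w ∂(spaceTime μ)} ≤
    C * 7 ^ q * ∫⁻ y, g y ^ q * ENNReal.ofReal (ω y) ∂(spaceTime μ) := by
  classical
  have := hX.sigmaFinite
  have hcount := fun k => D.countable_index τ k
  set gn : ℕ → X × ℝ → ℝ≥0∞ := fun n y => min (g y) n with hgn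
  have hgnm : ∀ n, AEMeasurable (gn n) (spaceTime μ) := fun n => hg.min aemeasurable_const
  set E : Finset (Σ k, D.I τ k) × ℕ → Set (X × ℝ) := fun z =>
    ⋃ i ∈ z.1, D.Q τ i.1 i.2 ×ˢ {t ∈ Icc (-(z.2 : ℝ)) z.2 |
        ξ * spaceTime μ (D.rectPlus p γ τ i.1 i.2 t) ≤
          ∫⁻ y in D.rectPlus p γ τ i.1 i.2 t, gn z.2 y ∂(spaceTime μ)} with hE
  have hmono : Monotone E := by
    rintro ⟨F, n⟩ ⟨F', n'⟩ ⟨hF, hn⟩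
    simp only at hF hn
    have hn' : (n : ℝ) ≤ n' := by exact_mod_cast hn
    have hn'' : (n : ℝ≥0∞) ≤ n' := by exact_mod_cast hn
    refine biUnion_mono hF fun i _ => prod_mono Subset.rfl ?_
    rintro t ⟨⟨h1, h2⟩, h3⟩
    refine ⟨⟨by linarith, by linarith⟩, h3.trans (lintegral_mono fun y => ?_)⟩
    exact min_le_min le_rfl hn''
  have hsub : {y | ∃ (k : ℤ) (α : D.I τ k), y.1 ∈ D.Q τ k α ∧
        ξ * spaceTime μ (D.rectPlus p γ τ k α y.2) <
          ∫⁻ w in D.rectPlus p γ τ k α y.2, g w ∂(spaceTime μ)} ⊆ ⋃ z, E z := by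
    rintro ⟨x, t⟩ ⟨k, α, hx, hlt⟩
    simp only at hx hlt
    have hsup : ∫⁻ w in D.rectPlus p γ τ k α t, g w ∂(spaceTime μ) =
        ⨆ n, ∫⁻ w in D.rectPlus p γ τ k α t, gn n w ∂(spaceTime μ) := by
      rw [← lintegral_iSup' (fun n => (hgnm n).restrict)
        (Filter.Eventually.of_forall fun y n n' hn => min_le_min le_rfl (by exact_mod_cast hn))]
      refine lintegral_congr fun y => ?_
      simp only [hgn]
      rw [← inf_iSup_eq, ENNReal.iSup_natCast, inf_top_eq]
    rw [hsup, lt_iSup_iff] at hlt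
    obtain ⟨n, hn⟩ := hlt
    obtain ⟨n', hn'⟩ := exists_nat_ge |t|
    refine mem_iUnion.2 ⟨({⟨k, α⟩}, max n n'), ?_⟩
    simp only [hE, Finset.mem_singleton, iUnion_iUnion_eq_left]
    have h1 : |t| ≤ ((max n n' : ℕ) : ℝ) := hn'.trans (by exact_mod_cast le_max_right _ _)
    refine ⟨hx, abs_le.1 h1, hn.le.trans (lintegral_mono fun y => ?_)⟩
    exact min_le_min le_rfl (by exact_mod_cast le_max_left _ _)
  refine (mul_le_mul' le_rfl (measure_mono hsub)).trans ?_
  rw [hmono.directed_le.measure_iUnion, ENNReal.mul_iSup]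
  refine iSup_le fun z => ?_
  refine (D.weak_type_finset hX hp hq hγ0 hγ1 hω hC τ z.1 z.2 (hgnm z.2) (B := z.2)
    (fun y => by simp [hgn]) hξ0).trans ?_
  gcongr with y
  exact min_le_left _ _

/-- The `A_q`-type condition on the dyadic rectangles is sufficient for the weak type bound. -/
theorem CubeCondition.weakBounded [TopologicalSpace X] (hX : IsHomogeneousType ρ K₀ μ)
    {D : AdjacentDyadicSystem ρ K₀ μ} {p q γ : ℝ} (hp : 1 ≤ p) (hq : 1 < q) (hγ0 : 0 ≤ γ)
    (hγ1 : γ < 1) {ω : X × ℝ → ℝ} (hω : IsWeight ρ p μ ω) {C : ℝ≥0}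
    (hC : D.CubeCondition p q γ ω C) : MaximalPlusWeakBounded D p q γ ω := by
  have := hX.sigmaFinite
  have hq0 : 0 < q := by linarith
  set κ : ℝ≥0∞ := ENNReal.ofReal ((1 - γ) / 2) with hκ
  have hκ0 : κ ≠ 0 := (ENNReal.ofReal_pos.2 (by linarith)).ne'
  have hκt : κ ≠ ∞ := ENNReal.ofReal_ne_top
  set K : ℝ≥0∞ := ((D.N : ℝ≥0∞) * (C * 7 ^ q)) ^ (1 / q) / κ with hK
  have hKt : K ≠ ∞ := by
    refine ENNReal.div_ne_top (ENNReal.rpow_ne_top_of_nonneg (by positivity) ?_) hκ0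
    exact ENNReal.mul_ne_top (by simp) (ENNReal.mul_ne_top (by simp)
      (ENNReal.rpow_ne_top_of_nonneg hq0.le (by norm_num)))
  refine ⟨K.toNNReal, fun f hf _ => ⟨D.aemeasurable_maximalPlus p γ f, ?_⟩⟩
  rw [ENNReal.coe_toNNReal hKt]
  refine iSup₂_le fun r hr => ?_
  rw [← weightMeasure_apply]
  set ξ := ENNReal.ofReal r
  have hξ0 : ξ ≠ 0 := (ENNReal.ofReal_pos.2 hr).ne'
  set J := ∫⁻ y, ‖f y‖ₑ ^ q * ENNReal.ofReal (ω y) ∂(spaceTime μ) with hJ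
  have hsub : {y | ξ < D.maximalPlus p γ f y} ⊆ ⋃ τ : Fin D.N,
      {y | ∃ (k : ℤ) (α : D.I τ k), y.1 ∈ D.Q τ k α ∧
        ξ * spaceTime μ (D.rectPlus p γ τ k α y.2) <
          ∫⁻ w in D.rectPlus p γ τ k α y.2, ‖f w‖ₑ ∂(spaceTime μ)} := by
    intro y hy
    simp only [maximalPlus, mem_ofPred_eq, lt_iSup_iff, setLAverage_eq] at hy
    obtain ⟨τ, k, α, hmem, hlt⟩ := hy
    refine mem_iUnion.2 ⟨τ, k, α, hmem.1, ?_⟩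
    have h0 : spaceTime μ (D.rectPlus p γ τ k α y.2) ≠ 0 := by
      rw [D.measure_rectPlus]
      have := Real.rpow_pos_of_pos D.δ_pos ((k : ℝ) * p)
      have h1 : 0 < (1 - γ) * D.δ ^ ((k : ℝ) * p) := mul_pos (by linarith) this
      exact mul_ne_zero (D.measure_cube_pos hX τ k α).ne' (ENNReal.ofReal_pos.2 h1).ne'
    have ht : spaceTime μ (D.rectPlus p γ τ k α y.2) ≠ ∞ := by
      rw [D.measure_rectPlus]
      exact ENNReal.mul_ne_top (D.measure_cube_lt_top hX τ k α).ne ENNReal.ofReal_ne_top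
    rwa [ENNReal.lt_div_iff_mul_lt (Or.inl h0) (Or.inl ht)] at hlt
  have hmain : κ ^ q * ξ ^ q * weightMeasure μ ω {y | ξ < D.maximalPlus p γ f y} ≤
      (D.N : ℝ≥0∞) * (C * 7 ^ q) * J := by
    calc _ ≤ κ ^ q * ξ ^ q * ∑ τ : Fin D.N, weightMeasure μ ω
          {y | ∃ (k : ℤ) (α : D.I τ k), y.1 ∈ D.Q τ k α ∧
            ξ * spaceTime μ (D.rectPlus p γ τ k α y.2) <
              ∫⁻ w in D.rectPlus p γ τ k α y.2, ‖f w‖ₑ ∂(spaceTime μ)} := by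
          gcongr
          exact (measure_mono hsub).trans (measure_iUnion_fintype_le _ _)
      _ ≤ ∑ τ : Fin D.N, C * 7 ^ q * J := by
          rw [Finset.mul_sum]
          exact Finset.sum_le_sum fun τ _ =>
            D.weak_type_system hX hp hq hγ0 hγ1 hω hC τ hf.enorm hξ0
      _ = _ := by
          simp [mul_assoc]
  have h2 := ENNReal.rpow_le_rpow hmain (show 0 ≤ 1 / q by positivity)
  have hinv : 0 ≤ 1 / q := by positivity
  rw [ENNReal.mul_rpow_of_nonneg _ _ hinv, ENNReal.mul_rpow_of_nonneg _ _ hinv,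
    ENNReal.mul_rpow_of_nonneg _ _ hinv, ← ENNReal.rpow_mul, ← ENNReal.rpow_mul,
    mul_one_div_cancel hq0.ne', ENNReal.rpow_one, ENNReal.rpow_one] at h2
  have h3 : κ * (ξ * weightMeasure μ ω {y | ξ < D.maximalPlus p γ f y} ^ (1 / q)) ≤
      κ * (K * weightedNorm μ q ω f) := by
    rw [← mul_assoc, ← mul_assoc, hK, ENNReal.mul_div_cancel hκ0 hκt]
    exact h2
  exact (ENNReal.mul_le_mul_iff_right hκ0 hκt).1 h3

end AdjacentDyadicSystem

theorem ENNReal.div_mul_div_rpow_le_iff {a b v K : ℝ≥0∞} {q : ℝ} (hq : 1 < q) (hv0 : v ≠ 0)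
    (hvt : v ≠ ∞) : a / v * (b / v) ^ (q - 1) ≤ K ↔ a * b ^ (q - 1) ≤ K * v ^ q := by
  have e : v ^ q = v * v ^ (q - 1) := by
    conv_lhs => rw [show q = 1 + (q - 1) by ring]
    rw [ENNReal.rpow_add_of_nonneg _ _ zero_le_one (by linarith), ENNReal.rpow_one]
  have h0 : v ^ q ≠ 0 := (ENNReal.rpow_pos (pos_iff_ne_zero.2 hv0) hvt).ne'
  have ht : v ^ q ≠ ∞ := ENNReal.rpow_ne_top_of_nonneg (by linarith) hvt
  rw [← ENNReal.div_le_iff h0 ht, ENNReal.div_rpow_of_nonneg _ _ (by linarith), e]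
  rw [div_eq_mul_inv, div_eq_mul_inv, div_eq_mul_inv, ENNReal.mul_inv (Or.inl hv0) (Or.inl hvt)]
  rw [show a * v⁻¹ * (b ^ (q - 1) * (v ^ (q - 1))⁻¹) =
    a * b ^ (q - 1) * (v⁻¹ * (v ^ (q - 1))⁻¹) by ring]

section Muckenhoupt

variable {X : Type*} [TopologicalSpace X] [MeasurableSpace X] {ρ : X → X → ℝ} {K₀ : ℝ}
  {μ : Measure X} {p q γ : ℝ} {ω : X × ℝ → ℝ}

theorem aqPlusConst_le_iff (hX : IsHomogeneousType ρ K₀ μ) (hq : 1 < q) (hγ : γ < 1) {K : ℝ≥0∞} :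
    aqPlusConst ρ p μ q γ ω ≤ K ↔ ∀ (x : X) (t l : ℝ), 0 < l →
      weightMeasure μ ω (cylinderMinus ρ p γ x t l) *
        dualMeasure μ q ω (cylinderPlus ρ p γ x t l) ^ (q - 1) ≤
      K * (μ (qBall ρ x l) * ENNReal.ofReal ((1 - γ) * l ^ p)) ^ q := by
  have := hX.sigmaFinite
  simp only [aqPlusConst, iSup_le_iff]
  refine forall₄_congr fun x t l hl => ?_
  have h1 : 0 < (1 - γ) * l ^ p := mul_pos (by linarith) (Real.rpow_pos_of_pos hl p)
  have e1 : spaceTime μ (cylinderMinus ρ p γ x t l) =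
      μ (qBall ρ x l) * ENNReal.ofReal ((1 - γ) * l ^ p) := by
    rw [cylinderMinus, spaceTime_prod, Real.volume_Ioo]
    congr 2; ring
  have e2 : spaceTime μ (cylinderPlus ρ p γ x t l) =
      μ (qBall ρ x l) * ENNReal.ofReal ((1 - γ) * l ^ p) := by
    rw [cylinderPlus, spaceTime_prod, Real.volume_Ioo]
    congr 2; ring
  rw [setLAverage_eq, setLAverage_eq, e1, e2, ← weightMeasure_apply, ← dualMeasure_apply]
  exact ENNReal.div_mul_div_rpow_le_iff hq
    (mul_ne_zero (hX.ball_pos x l hl).ne' (ENNReal.ofReal_pos.2 h1).ne')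
    (ENNReal.mul_ne_top (hX.ball_lt_top x l hl).ne ENNReal.ofReal_ne_top)

/-- The `A_q`-type estimate on two cylinders over the ball `B(x,l)` of duration `l^p`, separated by
a time lag `G`. -/
def HasLagEstimate (ρ : X → X → ℝ) (μ : Measure X) (p q : ℝ) (ω : X × ℝ → ℝ) (C : ℝ≥0) (x : X)
    (l G : ℝ) : Prop :=
  ∀ t : ℝ, weightMeasure μ ω (qBall ρ x l ×ˢ Ioo (t - l ^ p) t) *
      dualMeasure μ q ω (qBall ρ x l ×ˢ Ioo (t + G) (t + G + l ^ p)) ^ (q - 1) ≤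
    C * (μ (qBall ρ x l) * ENNReal.ofReal (l ^ p)) ^ q

/-- Lag estimates hold at all places and scales, with lags bounded at each scale. -/
def HasBoundedLagEstimates (ρ : X → X → ℝ) (μ : Measure X) (p q : ℝ) (ω : X × ℝ → ℝ) : Prop :=
  ∃ (A : ℝ) (C : ℝ≥0), ∀ (x : X) (l : ℝ), 0 < l →
    ∃ G ∈ Icc 0 (A * l ^ p), HasLagEstimate ρ μ p q ω C x l G

theorem MemAqPlus.hasBoundedLagEstimates (hX : IsHomogeneousType ρ K₀ μ) (hp : 0 < p) (hq : 1 < q)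
    (hγ0 : 0 ≤ γ) (hγ1 : γ < 1) (h : MemAqPlus ρ p μ q γ ω) :
    HasBoundedLagEstimates ρ μ p q ω := by
  have hq0 : 0 < q := by linarith
  have hA := (aqPlusConst_le_iff hX hq hγ1).1 (le_refl (aqPlusConst ρ p μ q γ ω))
  set K := aqPlusConst ρ p μ q γ ω with hK
  have hKt : K ≠ ∞ := h.2.ne
  have h1γ : 0 < 1 - γ := by linarith
  set b : ℝ := (1 / (1 - γ)) ^ (1 / p) with hb
  have hb1 : 1 ≤ b := Real.one_le_rpow (by rw [le_div_iff₀ h1γ]; linarith) (by positivity)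
  obtain ⟨C, hC⟩ := hX.exists_measure_qBall_mul_le b
  refine ⟨2 * γ / (1 - γ), K.toNNReal * C ^ q, fun x l hl => ?_⟩
  have hlp : 0 < l ^ p := Real.rpow_pos_of_pos hl p
  have hblp : (1 - γ) * (b * l) ^ p = l ^ p := by
    rw [Real.mul_rpow (by positivity) hl.le, hb, ← Real.rpow_mul (by positivity),
      one_div_mul_cancel hp.ne', Real.rpow_one]
    field_simp
  have hG : γ * (b * l) ^ p = γ / (1 - γ) * l ^ p := by
    rw [← hblp]; field_simp
  have hblp' : (b * l) ^ p = γ / (1 - γ) * l ^ p + l ^ p := by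
    rw [← hG]; linarith
  have hl' : l ≤ b * l := le_mul_of_one_le_left hl.le hb1
  refine ⟨2 * γ / (1 - γ) * l ^ p, ⟨by positivity, le_rfl⟩, fun t => ?_⟩
  have h2 := hA x (t + γ / (1 - γ) * l ^ p) (b * l) (by positivity)
  rw [hblp] at h2
  have e : 2 * γ / (1 - γ) = γ / (1 - γ) + γ / (1 - γ) := by ring
  calc _ ≤ weightMeasure μ ω (cylinderMinus ρ p γ x (t + γ / (1 - γ) * l ^ p) (b * l)) *
        dualMeasure μ q ω (cylinderPlus ρ p γ x (t + γ / (1 - γ) * l ^ p) (b * l)) ^ (q - 1) := by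
        refine mul_le_mul' (measure_mono ?_) (ENNReal.rpow_le_rpow (measure_mono ?_) (by linarith))
        · refine prod_mono (qBall_subset_qBall hl') (Ioo_subset_Ioo ?_ ?_)
          · rw [hblp']; linarith
          · rw [hG]; linarith
        · refine prod_mono (qBall_subset_qBall hl') (Ioo_subset_Ioo ?_ ?_)
          · rw [hG, e]; linarith
          · rw [hblp', e]; linarith
    _ ≤ _ := h2
    _ ≤ K * (C * μ (qBall ρ x l) * ENNReal.ofReal (l ^ p)) ^ q := by
        gcongr
        exact hC x l hl
    _ = _ := by
        rw [ENNReal.coe_mul, ENNReal.coe_toNNReal hKt, ENNReal.coe_rpow_of_nonneg _ hq0.le,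
          mul_assoc (C : ℝ≥0∞), ENNReal.mul_rpow_of_nonneg (C : ℝ≥0∞) _ hq0.le, mul_assoc]

end Muckenhoupt

namespace AdjacentDyadicSystem

variable {X : Type*} [TopologicalSpace X] [MeasurableSpace X] {ρ : X → X → ℝ} {K₀ : ℝ}
  {μ : Measure X}

/-- Testing the weak type bound on `ω^{1-q'}`. -/
theorem weight_mul_dual_le_of_weakNorm_le (hX : IsHomogeneousType ρ K₀ μ)
    (D : AdjacentDyadicSystem ρ K₀ μ) {p q γ : ℝ} (hq : 1 < q) (hγ1 : γ < 1) {ω : X × ℝ → ℝ}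
    (hω : IsWeight ρ p μ ω) {C : ℝ≥0}
    (hC : ∀ f : X × ℝ → ℂ, AEMeasurable f (spaceTime μ) → weightedNorm μ q ω f < ∞ →
      weakNorm μ q ω (D.maximalPlus p γ f) ≤ (C : ℝ≥0∞) * weightedNorm μ q ω f)
    (τ : Fin D.N) (k : ℤ) (α : D.I τ k) (a h : ℝ) :
    weightMeasure μ ω (D.Q τ k α ×ˢ
        Ioo (a + h - D.δ ^ ((k : ℝ) * p)) (a - γ * D.δ ^ ((k : ℝ) * p))) *
      dualMeasure μ q ω (D.Q τ k α ×ˢ Ioo a (a + h)) ^ (q - 1) ≤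
    (C * 2) ^ q * (μ (D.Q τ k α) * ENNReal.ofReal ((1 - γ) * D.δ ^ ((k : ℝ) * p))) ^ q := by
  classical
  have := hX.sigmaFinite
  have hq0 : 0 < q := by linarith
  set L := D.δ ^ ((k : ℝ) * p) with hL
  have hL0 : 0 < L := Real.rpow_pos_of_pos D.δ_pos _
  set v := μ (D.Q τ k α) * ENNReal.ofReal ((1 - γ) * L) with hv
  have hv0 : v ≠ 0 := mul_ne_zero (D.measure_cube_pos hX τ k α).ne'
    (ENNReal.ofReal_pos.2 (mul_pos (by linarith) hL0)).ne'
  have hvt : v ≠ ∞ := ENNReal.mul_ne_top (D.measure_cube_lt_top hX τ k α).ne ENNReal.ofReal_ne_top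
  set U := D.Q τ k α ×ˢ Ioo a (a + h) with hU
  have hUm : NullMeasurableSet U (spaceTime μ) :=
    (D.measurable_cube τ k α).prod measurableSet_Ioo.nullMeasurableSet
  have hUt : spaceTime μ U ≠ ∞ := by
    rw [hU, spaceTime_prod, Real.volume_Ioo]
    exact ENNReal.mul_ne_top (D.measure_cube_lt_top hX τ k α).ne ENNReal.ofReal_ne_top
  set W := weightMeasure μ ω (D.Q τ k α ×ˢ Ioo (a + h - L) (a - γ * L)) with hW
  set σ : X × ℝ → ℝ := fun y => ω y ^ (1 - Real.conjExponent q) with hσ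
  have hσm : AEMeasurable σ (spaceTime μ) := hω.aemeasurable.pow_const _
  set A : ℕ → Set (X × ℝ) := fun n => {y ∈ U | 0 < ω y ∧ σ y ≤ n} with hA
  have hAm : ∀ n, NullMeasurableSet (A n) (spaceTime μ) := fun n =>
    hUm.inter ((nullMeasurableSet_lt aemeasurable_const hω.aemeasurable).inter
      (nullMeasurableSet_le hσm aemeasurable_const))
  have hAmono : Monotone A := fun n m hnm y hy =>
    ⟨hy.1, hy.2.1, hy.2.2.trans (by exact_mod_cast hnm)⟩
  have hsup : dualMeasure μ q ω U = ⨆ n, dualMeasure μ q ω (A n) := by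
    rw [← hAmono.directed_le.measure_iUnion]
    refine measure_congr ?_
    have hae : ∀ᵐ y ∂(dualMeasure μ q ω), 0 < ω y :=
      (withDensity_absolutelyContinuous _ _).ae_le hω.pos
    filter_upwards [hae] with y hy
    refine propext ⟨fun hyU => ?_, fun hyA => ?_⟩
    · obtain ⟨n, hn⟩ := exists_nat_ge (σ y)
      exact mem_iUnion.2 ⟨n, hyU, hy, hn⟩
    · obtain ⟨n, hn⟩ := mem_iUnion.1 hyA
      exact hn.1
  have hn : ∀ n, W * dualMeasure μ q ω (A n) ^ (q - 1) ≤ (C * 2) ^ q * v ^ q := by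
    intro n
    set s := dualMeasure μ q ω (A n) with hs
    have hs' : s = ∫⁻ y in A n, ENNReal.ofReal (σ y) ∂(spaceTime μ) := dualMeasure_apply _ _ _ _
    rcases eq_or_ne s 0 with hs0 | hs0
    · rw [hs0, ENNReal.zero_rpow_of_pos (by linarith), mul_zero]
      exact zero_le
    have hst : s ≠ ∞ := by
      have h1 : s ≤ ∫⁻ y in A n, (n : ℝ≥0∞) ∂(spaceTime μ) := by
        rw [hs']
        refine lintegral_mono_ae ((ae_restrict_iff'₀ (hAm n)).2
          (Filter.Eventually.of_forall fun y hy => ?_))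
        exact ENNReal.ofReal_le_of_le_toReal (by simpa using hy.2.2)
      rw [setLIntegral_const] at h1
      refine ne_top_of_le_ne_top (ENNReal.mul_ne_top (by simp) ?_) h1
      exact ne_top_of_le_ne_top hUt (measure_mono fun y hy => hy.1)
    set f : X × ℝ → ℂ := (A n).indicator fun y => ((σ y : ℝ) : ℂ) with hf
    have hfm : AEMeasurable f (spaceTime μ) :=
      (Complex.measurable_ofReal.comp_aemeasurable hσm).indicator₀ (hAm n)
    have hfn : ∀ y, ‖f y‖ₑ = (A n).indicator (fun y => ENNReal.ofReal (σ y)) y := by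
      intro y
      by_cases hy : y ∈ A n
      · rw [hf, indicator_of_mem hy, indicator_of_mem hy]
        have : 0 ≤ σ y := Real.rpow_nonneg hy.2.1.le _
        rw [← ofReal_norm, Complex.norm_real, Real.norm_of_nonneg this]
      · rw [hf, indicator_of_notMem hy, indicator_of_notMem hy]
        simp
    have hfq : ∀ y, ‖f y‖ₑ ^ q * ENNReal.ofReal (ω y) =
        (A n).indicator (fun y => ENNReal.ofReal (σ y)) y := by
      intro y
      rw [hfn]
      by_cases hy : y ∈ A n
      · rw [indicator_of_mem hy]
        have h0 : 0 < ω y := hy.2.1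
        have h1 : 0 ≤ σ y := Real.rpow_nonneg h0.le _
        rw [ENNReal.ofReal_rpow_of_nonneg h1 hq0.le,
          ← ENNReal.ofReal_mul (Real.rpow_nonneg h1 _)]
        congr 1
        simp only [hσ]
        rw [← Real.rpow_mul h0.le]
        nth_rw 2 [← Real.rpow_one (ω y)]
        rw [← Real.rpow_add h0]
        congr 1
        have hq1 : q - 1 ≠ 0 := by linarith
        rw [show Real.conjExponent q = q / (q - 1) from rfl]
        field_simp
        ring
      · rw [indicator_of_notMem hy, ENNReal.zero_rpow_of_pos hq0, zero_mul]
    have hnorm : weightedNorm μ q ω f = s ^ (1 / q) := by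
      rw [weightedNorm, hs', ← lintegral_indicator₀ (hAm n)]
      simp only [hfq]
    have hweak := hC f hfm (by
      rw [hnorm]; exact ENNReal.rpow_lt_top_of_nonneg (by positivity) hst)
    rw [hnorm] at hweak
    set ξ := s / (2 * v) with hξ
    have h2v0 : 2 * v ≠ 0 := mul_ne_zero (by norm_num) hv0
    have h2vt : 2 * v ≠ ∞ := ENNReal.mul_ne_top (by norm_num) hvt
    have hξ0 : ξ ≠ 0 := (ENNReal.div_pos hs0 h2vt).ne'
    have hξt : ξ ≠ ∞ := ENNReal.div_ne_top hst h2v0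
    have hξlt : ξ < s / v := by
      have : s / v = 2 * ξ := by
        rw [hξ, ← ENNReal.mul_div_mul_left s v (c := 2) (by norm_num) (by norm_num), mul_div_assoc]
      rw [this, two_mul]
      exact ENNReal.lt_add_right hξt hξ0
    have hr : ENNReal.ofReal ξ.toReal = ξ := ENNReal.ofReal_toReal hξt
    have hsub : D.Q τ k α ×ˢ Ioo (a + h - L) (a - γ * L) ⊆
        {y | ENNReal.ofReal ξ.toReal < D.maximalPlus p γ f y} := by
      rintro ⟨x, t⟩ ⟨hx, ht1, ht2⟩
      simp only at hx ht1 ht2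
      simp only [mem_ofPred_eq]
      rw [hr]
      refine hξlt.trans_le ?_
      refine le_trans ?_ (le_iSup_of_le τ (le_iSup_of_le k (le_iSup_of_le α (le_iSup_of_le
        ((D.mem_rect_self_iff p τ k α (x, t)).2 hx) le_rfl))))
      rw [setLAverage_eq, D.measure_rectPlus]
      refine ENNReal.div_le_div_right ?_ _
      rw [hs']
      calc ∫⁻ y in A n, ENNReal.ofReal (σ y) ∂(spaceTime μ)
          = ∫⁻ y in A n, ‖f y‖ₑ ∂(spaceTime μ) := by
            refine lintegral_congr_ae ((ae_restrict_iff'₀ (hAm n)).2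
              (Filter.Eventually.of_forall fun y hy => ?_))
            simp only
            rw [hfn, indicator_of_mem hy]
        _ ≤ _ := by
            refine lintegral_mono_set fun y hy => ⟨hy.1.1, ?_, ?_⟩
            · have := hy.1.2.1
              simp only
              linarith
            · have := hy.1.2.2
              simp only
              linarith
    have hle : ξ * W ^ (1 / q) ≤ C * s ^ (1 / q) := by
      refine le_trans ?_ ((le_iSup₂_of_le (f := fun (ξ : ℝ) (_ : 0 < ξ) => ENNReal.ofReal ξ *
        (∫⁻ y in {y | ENNReal.ofReal ξ < D.maximalPlus p γ f y},
          ENNReal.ofReal (ω y) ∂(spaceTime μ)) ^ (1 / q)) ξ.toReal (ENNReal.toReal_pos hξ0 hξt)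
        le_rfl).trans hweak)
      rw [← weightMeasure_apply, hr]
      rw [hr] at hsub
      exact mul_le_mul' le_rfl (ENNReal.rpow_le_rpow (measure_mono hsub) (by positivity))
    have hle2 := ENNReal.rpow_le_rpow hle hq0.le
    rw [ENNReal.mul_rpow_of_nonneg _ _ hq0.le, ENNReal.mul_rpow_of_nonneg _ _ hq0.le,
      ← ENNReal.rpow_mul, ← ENNReal.rpow_mul, one_div_mul_cancel hq0.ne', ENNReal.rpow_one,
      ENNReal.rpow_one, hξ, ENNReal.div_rpow_of_nonneg _ _ hq0.le] at hle2
    have hV0 : (2 * v) ^ q ≠ 0 := (ENNReal.rpow_pos (pos_iff_ne_zero.2 h2v0) h2vt).ne'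
    have hVt : (2 * v) ^ q ≠ ∞ := ENNReal.rpow_ne_top_of_nonneg hq0.le h2vt
    have e : s ^ q = s * s ^ (q - 1) := by
      conv_lhs => rw [show q = 1 + (q - 1) by ring]
      rw [ENNReal.rpow_add_of_nonneg _ _ zero_le_one (by linarith), ENNReal.rpow_one]
    have hle3 : s * (W * s ^ (q - 1)) ≤ s * ((C * 2) ^ q * v ^ q) := by
      calc s * (W * s ^ (q - 1)) = (2 * v) ^ q * (s ^ q / (2 * v) ^ q * W) := by
            rw [← mul_assoc ((2 * v) ^ q), ENNReal.mul_div_cancel hV0 hVt, e]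
            ring
        _ ≤ (2 * v) ^ q * ((C : ℝ≥0∞) ^ q * s) := by gcongr
        _ = _ := by
            rw [ENNReal.mul_rpow_of_nonneg 2 v hq0.le,
              ENNReal.mul_rpow_of_nonneg (C : ℝ≥0∞) 2 hq0.le]
            ring
    exact (ENNReal.mul_le_mul_iff_right hs0 hst).1 hle3
  rw [hsup]
  have hpow : (⨆ n, dualMeasure μ q ω (A n)) ^ (q - 1) = ⨆ n, dualMeasure μ q ω (A n) ^ (q - 1) :=
    (ENNReal.orderIsoRpow (q - 1) (by linarith)).map_iSup _
  rw [hpow, ENNReal.mul_iSup]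
  exact iSup_le hn

end AdjacentDyadicSystem

section Uniform

variable {X : Type*} [TopologicalSpace X] [MeasurableSpace X] {ρ : X → X → ℝ} {K₀ : ℝ}
  {μ : Measure X} {p q γ ε : ℝ} {ω : X × ℝ → ℝ}

theorem MemAqPlus.of_hasLagEstimate (hX : IsHomogeneousType ρ K₀ μ) (hq : 1 < q) (hγ0 : 0 ≤ γ)
    (hγ1 : γ < 1) (hω : IsWeight ρ p μ ω) {C : ℝ≥0}
    (h : ∀ (x : X) (l : ℝ), 0 < l → HasLagEstimate ρ μ p q ω C x l (2 * γ * l ^ p)) :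
    MemAqPlus ρ p μ q γ ω := by
  have hq0 : 0 < q := by linarith
  refine ⟨hω, ?_⟩
  have h1γ : 0 < 1 - γ := by linarith
  set κ : ℝ≥0∞ := ENNReal.ofReal (1 / (1 - γ)) with hκ
  have hκt : C * κ ^ q < ∞ :=
    (ENNReal.mul_ne_top (by simp) (ENNReal.rpow_ne_top_of_nonneg hq0.le ENNReal.ofReal_ne_top)).lt_top
  refine lt_of_le_of_lt ((aqPlusConst_le_iff hX hq hγ1).2 fun x t l hl => ?_) hκt
  have hlp : 0 < l ^ p := Real.rpow_pos_of_pos hl p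
  have hγlp : 0 ≤ γ * l ^ p := by positivity
  refine le_trans ?_ ((h x l hl (t - γ * l ^ p)).trans (le_of_eq ?_))
  · refine mul_le_mul' (measure_mono ?_) (ENNReal.rpow_le_rpow (measure_mono ?_) (by linarith))
    · exact prod_mono Subset.rfl (Ioo_subset_Ioo (by linarith) (by linarith))
    · exact prod_mono Subset.rfl (Ioo_subset_Ioo (by linarith) (by linarith))
  · have : ENNReal.ofReal (l ^ p) = κ * ENNReal.ofReal ((1 - γ) * l ^ p) := by
      rw [hκ, ← ENNReal.ofReal_mul (by positivity)]
      congr 1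
      field_simp
    rw [this, mul_left_comm, ENNReal.mul_rpow_of_nonneg κ _ hq0.le, mul_assoc]

theorem MemAqPlus.hasLagEstimate_zero (hX : IsHomogeneousType ρ K₀ μ) (hq : 1 < q)
    (h : MemAqPlus ρ p μ q 0 ω) : ∃ C : ℝ≥0, ∀ (x : X) (l : ℝ), 0 < l →
      HasLagEstimate ρ μ p q ω C x l 0 := by
  have hA := (aqPlusConst_le_iff hX hq one_pos).1 (le_refl (aqPlusConst ρ p μ q 0 ω))
  refine ⟨(aqPlusConst ρ p μ q 0 ω).toNNReal, fun x l hl t => ?_⟩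
  rw [ENNReal.coe_toNNReal h.2.ne]
  simpa [cylinderMinus, cylinderPlus] using hA x t l hl

end Uniform

namespace AdjacentDyadicSystem

variable {X : Type*} [TopologicalSpace X] [MeasurableSpace X] {ρ : X → X → ℝ} {K₀ : ℝ}
  {μ : Measure X}

theorem side_eq_zpow_rpow {X : Type*} [MeasurableSpace X] {ρ : X → X → ℝ} {K₀ : ℝ} {μ : Measure X}
    (D : AdjacentDyadicSystem ρ K₀ μ) (p : ℝ) (k : ℤ) :
    D.δ ^ ((k : ℝ) * p) = (D.δ ^ k) ^ p := by
  rw [Real.rpow_mul D.δ_pos.le, Real.rpow_intCast]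

/-- Lag estimates on balls give the condition on the dyadic rectangles, each of which is contained in
a cylinder over the ball of radius `Λ δ^k` with the same centre. -/
theorem CubeCondition.of_hasLagEstimate (hX : IsHomogeneousType ρ K₀ μ)
    (D : AdjacentDyadicSystem ρ K₀ μ) {p q γ Λ : ℝ} (hp : 0 < p) (hq : 1 < q) (hγ0 : 0 ≤ γ)
    (hΛ1 : 1 ≤ Λ) (hΛ : 2 * K₀ * D.C₀ ≤ Λ) {ω : X × ℝ → ℝ} {C : ℝ≥0}
    (h : ∀ (x : X) (l : ℝ), 0 < l → HasLagEstimate ρ μ p q ω C x l (γ / Λ ^ p * l ^ p)) :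
    ∃ C' : ℝ≥0, D.CubeCondition p q γ ω C' := by
  have hq0 : 0 < q := by linarith
  have hK := hX.quasiMetric.one_le_const
  have hΛ0 : 0 < Λ := by linarith
  set c₁ : ℝ := D.c₀ / (3 * K₀ ^ 2) with hc₁
  have hc₁0 : 0 < c₁ := by have := D.c₀_pos; positivity
  obtain ⟨C', hC'⟩ := hX.exists_measure_qBall_mul_le (Λ / c₁)
  refine ⟨C * (C' * (Λ ^ p).toNNReal) ^ q, fun τ k α t => ?_⟩
  rw [D.side_eq_zpow_rpow]
  have hδk : 0 < D.δ ^ k := zpow_pos D.δ_pos k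
  set L := (D.δ ^ k) ^ p with hL
  have hL0 : 0 < L := Real.rpow_pos_of_pos hδk p
  have hlp : (Λ * D.δ ^ k) ^ p = Λ ^ p * L := Real.mul_rpow hΛ0.le hδk.le
  have hΛp : 1 ≤ Λ ^ p := Real.one_le_rpow hΛ1 hp.le
  have hLl : L ≤ Λ ^ p * L := le_mul_of_one_le_left hL0.le hΛp
  have hγL : 0 ≤ γ * L := by positivity
  have hG : γ / Λ ^ p * (Λ * D.δ ^ k) ^ p = γ * L := by
    rw [hlp]; field_simp
  have hQ : D.Q τ k α ⊆ qBall ρ (D.z τ k α) (Λ * D.δ ^ k) :=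
    (D.subset_ball τ k α).trans (qBall_subset_qBall (by gcongr))
  have hμ : μ (qBall ρ (D.z τ k α) (Λ * D.δ ^ k)) ≤ C' * μ (D.Q τ k α) := by
    have h1 := hC' (D.z τ k α) (c₁ * D.δ ^ k) (by positivity)
    rw [show Λ / c₁ * (c₁ * D.δ ^ k) = Λ * D.δ ^ k by field_simp] at h1
    refine h1.trans ?_
    gcongr
    exact D.ball_subset τ k α
  have h2 := h (D.z τ k α) (Λ * D.δ ^ k) (by positivity) t
  rw [hG, hlp] at h2
  have hrect : D.rectPlus p γ τ k α t = D.Q τ k α ×ˢ Ioo (t + γ * L) (t + L) := by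
    rw [rectPlus, D.side_eq_zpow_rpow]
  rw [hrect]
  calc _ ≤ _ := by
        refine mul_le_mul' (measure_mono (prod_mono hQ (Ioo_subset_Ioo ?_ le_rfl)))
          (ENNReal.rpow_le_rpow (measure_mono (prod_mono hQ (Ioo_subset_Ioo le_rfl ?_)))
            (by linarith))
        · linarith
        · linarith
    _ ≤ _ := h2
    _ ≤ C * ((C' * μ (D.Q τ k α)) * (ENNReal.ofReal (Λ ^ p) * ENNReal.ofReal L)) ^ q := by
        rw [ENNReal.ofReal_mul (by positivity)]
        gcongr
    _ = _ := by
        rw [mul_mul_mul_comm, ENNReal.mul_rpow_of_nonneg _ (_ * _) hq0.le, ENNReal.coe_mul,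
          ENNReal.coe_rpow_of_nonneg _ hq0.le, ENNReal.coe_mul, mul_assoc]
        rfl

/-- Every ball lies in a cube of comparable side length and measure. -/
theorem exists_cube_comparable (hX : IsHomogeneousType ρ K₀ μ) (hgeo : MonotoneGeodesic ρ)
    (D : AdjacentDyadicSystem ρ K₀ μ) {Λ : ℝ} (hΛ : 0 < Λ) :
    ∃ (A : ℝ) (C : ℝ≥0), 0 < A ∧ ∀ (x : X) (l : ℝ), 0 < l →
      ∃ (τ : Fin D.N) (k : ℤ) (α : D.I τ k), qBall ρ x l ⊆ D.Q τ k α ∧ Λ * l ≤ D.δ ^ k ∧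
        D.δ ^ k ≤ A * l ∧ μ (D.Q τ k α) ≤ C * μ (qBall ρ x l) := by
  have hK := hX.quasiMetric.one_le_const
  have hq := hX.quasiMetric
  obtain ⟨K, hK0, hgeoK⟩ := hgeo
  obtain ⟨Ca, hCa0, hCa⟩ := D.adjacent
  have hC₀ : 0 < D.C₀ := D.c₀_pos.trans_le D.c₀_le
  set C₁ : ℝ := 2 * K₀ * D.C₀ with hC₁
  have hC₁0 : 0 < C₁ := by positivity
  set c₁ : ℝ := D.c₀ / (3 * K₀ ^ 2) with hc₁
  have hc₁0 : 0 < c₁ := by have := D.c₀_pos; positivity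
  set M : ℝ := max 1 (Λ * (4 * K * K₀ * C₁)) with hM
  have hM0 : 0 < M := lt_of_lt_of_le one_pos (le_max_left _ _)
  obtain ⟨C, hC⟩ := hX.exists_measure_qBall_mul_le (Ca * M + 1)
  refine ⟨2 * K * Ca * M / c₁, C, by positivity, fun x l hl => ?_⟩
  have hMl : 0 < M * l := by positivity
  obtain ⟨τ, k, α, hsub, hdiam⟩ := hCa x (M * l) hMl
  have hδk : 0 < D.δ ^ k := zpow_pos D.δ_pos k
  have hl_le : l ≤ M * l := le_mul_of_one_le_left hl.le (le_max_left _ _)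
  have hx : x ∈ D.Q τ k α := hsub (hq.mem_qBall_self hMl)
  refine ⟨τ, k, α, (qBall_subset_qBall hl_le).trans hsub, ?_, ?_, ?_⟩
  · obtain ⟨w, hw1, hw2⟩ := exists_point_at_scale hq hX.unbounded hgeoK x
      (s := M * l / (2 * K)) (by positivity)
    have hwB : w ∈ qBall ρ x (M * l) := by
      have : K * (M * l / (2 * K)) = M * l / 2 := by field_simp
      exact lt_of_le_of_lt (hw2.trans_eq this) (by linarith)
    have h1 : ρ (D.z τ k α) w < C₁ * D.δ ^ k := D.subset_ball τ k α (hsub hwB)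
    have h2 : ρ (D.z τ k α) x < C₁ * D.δ ^ k := D.subset_ball τ k α hx
    rw [hq.symm] at h2
    have h3 := hq.quasi_triangle x w (D.z τ k α)
    have h4 : K₀ * (ρ x (D.z τ k α) + ρ (D.z τ k α) w) ≤
        K₀ * (C₁ * D.δ ^ k + C₁ * D.δ ^ k) := by gcongr
    have h5 : Λ * (4 * K * K₀ * C₁) * l / (2 * K) ≤ M * l / (2 * K) := by
      gcongr
      exact le_max_right _ _
    have h6 : Λ * (4 * K * K₀ * C₁) * l / (2 * K) = 2 * K₀ * C₁ * (Λ * l) := by field_simp; norm_num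
    have h7 : 2 * K₀ * C₁ * (Λ * l) ≤ 2 * K₀ * C₁ * D.δ ^ k := by linarith
    exact le_of_mul_le_mul_left h7 (by positivity)
  · obtain ⟨w, hw1, hw2⟩ := exists_point_at_scale hq hX.unbounded hgeoK (D.z τ k α)
      (s := c₁ * D.δ ^ k / (2 * K)) (by positivity)
    have hc : 0 < c₁ * D.δ ^ k := by positivity
    have hwB : w ∈ qBall ρ (D.z τ k α) (c₁ * D.δ ^ k) := by
      have : K * (c₁ * D.δ ^ k / (2 * K)) = c₁ * D.δ ^ k / 2 := by field_simp
      exact lt_of_le_of_lt (hw2.trans_eq this) (by linarith)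
    have h1 := hdiam _ (D.ball_subset τ k α (hq.mem_qBall_self hc)) _ (D.ball_subset τ k α hwB)
    have h2 : c₁ * D.δ ^ k / (2 * K) ≤ Ca * (M * l) := hw1.trans h1
    rw [div_le_iff₀ (by positivity)] at h2
    rw [div_mul_eq_mul_div, le_div_iff₀ hc₁0]
    linarith
  · refine (measure_mono fun y hy => ?_).trans (hC x l hl)
    have h1 := hdiam x hx y hy
    have : (Ca * M + 1) * l = Ca * (M * l) + l := by ring
    exact lt_of_le_of_lt h1 (by linarith)

/-- The weak type bound implies lag estimates with lags `γ L`, where `L` is comparable to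
`l ^ p`. -/
theorem exists_hasLagEstimate_of_weakBounded (hX : IsHomogeneousType ρ K₀ μ)
    (hgeo : MonotoneGeodesic ρ) (D : AdjacentDyadicSystem ρ K₀ μ) {p q γ : ℝ} (hp : 0 < p)
    (hq : 1 < q) (hγ1 : γ < 1) {ω : X × ℝ → ℝ} (hω : IsWeight ρ p μ ω)
    (h : MaximalPlusWeakBounded D p q γ ω) :
    ∃ (A : ℝ) (C : ℝ≥0), ∀ (x : X) (l : ℝ), 0 < l →
      ∃ L ∈ Icc 0 (A * l ^ p), HasLagEstimate ρ μ p q ω C x l (γ * L) := by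
  have hq0 : 0 < q := by linarith
  have h1γ : 0 < 1 - γ := by linarith
  obtain ⟨Cw, hCw⟩ := h
  obtain ⟨A, C, hA, hcube⟩ := D.exists_cube_comparable hX hgeo
    (Λ := (2 / (1 - γ)) ^ (1 / p)) (by positivity)
  refine ⟨A ^ p, (Cw * 2 * (C * ((1 - γ) * A ^ p).toNNReal)) ^ q, fun x l hl => ?_⟩
  obtain ⟨τ, k, α, hsub, hle1, hle2, hμ⟩ := hcube x l hl
  have hδk : 0 < D.δ ^ k := zpow_pos D.δ_pos k
  have hlp : 0 < l ^ p := Real.rpow_pos_of_pos hl p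
  have hL1 : 2 / (1 - γ) * l ^ p ≤ (D.δ ^ k) ^ p := by
    have h1 := Real.rpow_le_rpow (by positivity) hle1 hp.le
    rwa [Real.mul_rpow (by positivity) hl.le, ← Real.rpow_mul (by positivity),
      one_div_mul_cancel hp.ne', Real.rpow_one] at h1
  have hL2 : (D.δ ^ k) ^ p ≤ A ^ p * l ^ p := by
    rw [← Real.mul_rpow hA.le hl.le]
    exact Real.rpow_le_rpow hδk.le hle2 hp.le
  have hest := D.weight_mul_dual_le_of_weakNorm_le hX hq hγ1 hω
    (fun f hf hf' => (hCw f hf hf').2) τ k α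
  rw [D.side_eq_zpow_rpow] at hest
  set L := (D.δ ^ k) ^ p with hL
  have hL0 : 0 < L := Real.rpow_pos_of_pos hδk p
  refine ⟨L, ⟨hL0.le, hL2⟩, fun t => ?_⟩
  have hdur : l ^ p ≤ (1 - γ) * L / 2 := by
    have : 2 / (1 - γ) * l ^ p * ((1 - γ) / 2) ≤ L * ((1 - γ) / 2) := by gcongr
    rw [show 2 / (1 - γ) * l ^ p * ((1 - γ) / 2) = l ^ p by field_simp] at this
    linarith
  have h1 := hest (t + γ * L) ((1 - γ) * L / 2)
  calc _ ≤ _ := by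
        refine mul_le_mul' (measure_mono (prod_mono hsub (Ioo_subset_Ioo ?_ ?_)))
          (ENNReal.rpow_le_rpow (measure_mono (prod_mono hsub (Ioo_subset_Ioo le_rfl ?_)))
            (by linarith))
        · linarith
        · linarith
        · linarith
    _ ≤ _ := h1
    _ ≤ (Cw * 2) ^ q * ((C * μ (qBall ρ x l)) *
        (ENNReal.ofReal ((1 - γ) * A ^ p) * ENNReal.ofReal (l ^ p))) ^ q := by
        have hside : (1 - γ) * L ≤ (1 - γ) * A ^ p * l ^ p := by
          rw [mul_assoc]; gcongr
        rw [← ENNReal.ofReal_mul (by positivity)]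
        exact mul_le_mul' le_rfl (ENNReal.rpow_le_rpow
          (mul_le_mul' hμ (ENNReal.ofReal_le_ofReal hside)) hq0.le)
    _ = _ := by
        rw [mul_mul_mul_comm, ENNReal.mul_rpow_of_nonneg _ (μ _ * _) hq0.le, ← mul_assoc,
          ← ENNReal.mul_rpow_of_nonneg _ _ hq0.le, ENNReal.coe_rpow_of_nonneg _ hq0.le]
        simp only [ENNReal.coe_mul, ENNReal.coe_ofNat]
        rfl

end AdjacentDyadicSystem

section Chain

variable {X : Type*} [TopologicalSpace X] [MeasurableSpace X] {ρ : X → X → ℝ} {K₀ : ℝ}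
  {μ : Measure X} {p q : ℝ} {ω : X × ℝ → ℝ}

/-- The mass of a cylinder over `B(x,l)` of duration `l^p` is controlled by that of such a
cylinder over a nearby ball and at a bounded number of durations later. -/
def HasForwardSteps {X : Type*} [MeasurableSpace X] (ρ : X → X → ℝ) (p : ℝ) (ν : Measure (X × ℝ)) (κ : ℝ) (C : ℝ≥0) (d : ℝ) :
    Prop :=
  ∀ (x x' : X) (l : ℝ), 0 < l → ρ x x' ≤ κ * l → ∃ e ∈ Icc (l ^ p) (d * l ^ p), ∀ t : ℝ,
    ν (qBall ρ x l ×ˢ Ioo (t - l ^ p) t) ≤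
      C * ν (qBall ρ x' l ×ˢ Ioo (t + e - l ^ p) (t + e))

/-- The dual measure with time reversed. -/
noncomputable def reversedDualMeasure {X : Type*} [MeasurableSpace X] (μ : Measure X) (q : ℝ) (ω : X × ℝ → ℝ) : Measure (X × ℝ) :=
  (dualMeasure μ q ω).map fun y => (y.1, -y.2)

theorem reversedDualMeasure_prod_Ioo {X : Type*} [MeasurableSpace X] {μ : Measure X} {q : ℝ}
    {ω : X × ℝ → ℝ} {A : Set X} (hA : MeasurableSet A) (a b : ℝ) :
    reversedDualMeasure μ q ω (A ×ˢ Ioo a b) = dualMeasure μ q ω (A ×ˢ Ioo (-b) (-a)) := by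
  rw [reversedDualMeasure, Measure.map_apply (by fun_prop) (hA.prod measurableSet_Ioo)]
  congr 1
  ext ⟨x, t⟩
  simp only [mem_preimage, mem_prod, mem_Ioo]
  refine and_congr_right fun _ => ⟨fun h => ⟨?_, ?_⟩, fun h => ⟨?_, ?_⟩⟩ <;> linarith [h.1, h.2]

theorem HasBoundedLagEstimates.hasForwardSteps (hX : IsHomogeneousType ρ K₀ μ) (hp : 0 < p)
    (hq : 1 < q) (hω : IsWeight ρ p μ ω) (h : HasBoundedLagEstimates ρ μ p q ω) {κ : ℝ}
    (hκ : 0 ≤ κ) : ∃ (C : ℝ≥0) (d : ℝ), 1 ≤ C ∧ 1 ≤ d ∧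
      HasForwardSteps ρ p (weightMeasure μ ω) κ C d ∧
      HasForwardSteps ρ p (reversedDualMeasure μ q ω) κ C d := by
  have := hX.sigmaFinite
  have hσs : SFinite (spaceTime μ) := inferInstanceAs (SFinite (μ.prod volume))
  have hq0 : 0 < q := by linarith
  have hq1 : 0 < q - 1 := by linarith
  obtain ⟨A, C, hAC⟩ := h
  have hK := hX.quasiMetric.one_le_const
  set R : ℝ := K₀ * (κ + 1) with hR
  have hR1 : 1 ≤ R := by nlinarith
  have hR0 : 0 < R := by linarith
  obtain ⟨C', hC'⟩ := hX.exists_measure_qBall_le_of_dist_le κ R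
  set M : ℝ≥0 := C * (C' * (R ^ p).toNNReal) ^ q with hM
  have hA0 : 0 ≤ A := by
    obtain ⟨x⟩ := hX.nonempty
    obtain ⟨G, hG, -⟩ := hAC x 1 one_pos
    have := hG.1.trans hG.2
    simpa using this
  have key : ∀ (x x' : X) (l : ℝ), 0 < l → ρ x x' ≤ κ * l →
      ∃ G ∈ Icc 0 (A * R ^ p * l ^ p), ∀ t : ℝ,
        (∀ a b, Ioo a b ⊆ Ioo (t + G) (t + G + R ^ p * l ^ p) → b - a = l ^ p →
          weightMeasure μ ω (qBall ρ x l ×ˢ Ioo (t - l ^ p) t) ≤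
            M * weightMeasure μ ω (qBall ρ x' l ×ˢ Ioo a b)) ∧
        (∀ a b, Ioo a b ⊆ Ioo (t - R ^ p * l ^ p) t → b - a = l ^ p →
          dualMeasure μ q ω (qBall ρ x l ×ˢ Ioo (t + G) (t + G + l ^ p)) ^ (q - 1) ≤
            M * dualMeasure μ q ω (qBall ρ x' l ×ˢ Ioo a b) ^ (q - 1)) := by
    intro x x' l hl hxx'
    obtain ⟨G, hG, hest⟩ := hAC x (R * l) (by positivity)
    have hlp : 0 < l ^ p := Real.rpow_pos_of_pos hl p
    have hRl : (R * l) ^ p = R ^ p * l ^ p := Real.mul_rpow hR0.le hl.le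
    have hRp : 1 ≤ R ^ p := Real.one_le_rpow hR1 hp.le
    have hlRl : l ^ p ≤ R ^ p * l ^ p := le_mul_of_one_le_left hlp.le hRp
    rw [hRl, ← mul_assoc] at hG
    refine ⟨G, hG, fun t => ?_⟩
    have h1 := hest t
    rw [hRl] at h1
    have hB : qBall ρ x l ⊆ qBall ρ x (R * l) :=
      qBall_subset_qBall (le_mul_of_one_le_left hl.le hR1)
    have hB' : qBall ρ x' l ⊆ qBall ρ x (R * l) :=
      (hX.quasiMetric.qBall_subset hxx').trans (qBall_subset_qBall (le_of_eq (by rw [hR]; ring)))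
    set v := μ (qBall ρ x' l) * ENNReal.ofReal (l ^ p) with hv
    have hv0 : v ≠ 0 := mul_ne_zero (hX.ball_pos _ _ hl).ne' (ENNReal.ofReal_pos.2 hlp).ne'
    have hvt : v ≠ ∞ := ENNReal.mul_ne_top (hX.ball_lt_top _ _ hl).ne ENNReal.ofReal_ne_top
    have hvq0 : v ^ q ≠ 0 := (ENNReal.rpow_pos (pos_iff_ne_zero.2 hv0) hvt).ne'
    have hvqt : v ^ q ≠ ∞ := ENNReal.rpow_ne_top_of_nonneg hq0.le hvt
    have hbig : C * (μ (qBall ρ x (R * l)) * ENNReal.ofReal (R ^ p * l ^ p)) ^ q ≤ M * v ^ q := by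
      calc _ ≤ C * ((C' * μ (qBall ρ x' l)) * (ENNReal.ofReal (R ^ p) * ENNReal.ofReal (l ^ p))) ^ q
            := by
            rw [ENNReal.ofReal_mul (by positivity)]
            gcongr
            exact hC' x' x l hl (by rw [hX.quasiMetric.symm]; exact hxx')
        _ = _ := by
            rw [mul_mul_mul_comm, ENNReal.mul_rpow_of_nonneg _ (_ * _) hq0.le, hM, ENNReal.coe_mul,
              ENNReal.coe_rpow_of_nonneg _ hq0.le, ENNReal.coe_mul, mul_assoc]
            rfl
    have hHol : ∀ a b, b - a = l ^ p → v ^ q ≤ weightMeasure μ ω (qBall ρ x' l ×ˢ Ioo a b) *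
        dualMeasure μ q ω (qBall ρ x' l ×ˢ Ioo a b) ^ (q - 1) := fun a b hab => by
      have := measure_rpow_le_weighted hq hω.aemeasurable hω.pos (qBall ρ x' l ×ˢ Ioo a b)
      rwa [spaceTime_prod, Real.volume_Ioo, hab] at this
    refine ⟨fun a b hsub hab => ?_, fun a b hsub hab => ?_⟩
    · have h2 : weightMeasure μ ω (qBall ρ x l ×ˢ Ioo (t - l ^ p) t) * v ^ q ≤
          M * weightMeasure μ ω (qBall ρ x' l ×ˢ Ioo a b) * v ^ q := by
        calc _ ≤ weightMeasure μ ω (qBall ρ x (R * l) ×ˢ Ioo (t - R ^ p * l ^ p) t) *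
              (weightMeasure μ ω (qBall ρ x' l ×ˢ Ioo a b) *
                dualMeasure μ q ω (qBall ρ x (R * l) ×ˢ
                  Ioo (t + G) (t + G + R ^ p * l ^ p)) ^ (q - 1)) := by
              refine mul_le_mul' (measure_mono (prod_mono hB (Ioo_subset_Ioo (by linarith) le_rfl)))
                ((hHol a b hab).trans (mul_le_mul' le_rfl (ENNReal.rpow_le_rpow
                  (measure_mono (prod_mono hB' hsub)) hq1.le)))
          _ = weightMeasure μ ω (qBall ρ x' l ×ˢ Ioo a b) *
              (weightMeasure μ ω (qBall ρ x (R * l) ×ˢ Ioo (t - R ^ p * l ^ p) t) *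
                dualMeasure μ q ω (qBall ρ x (R * l) ×ˢ
                  Ioo (t + G) (t + G + R ^ p * l ^ p)) ^ (q - 1)) := by ring
          _ ≤ weightMeasure μ ω (qBall ρ x' l ×ˢ Ioo a b) * (M * v ^ q) :=
              mul_le_mul' le_rfl (h1.trans hbig)
          _ = _ := by ring
      exact (ENNReal.mul_le_mul_iff_left hvq0 hvqt).1 h2
    · have h2 : dualMeasure μ q ω (qBall ρ x l ×ˢ Ioo (t + G) (t + G + l ^ p)) ^ (q - 1) * v ^ q ≤
          M * dualMeasure μ q ω (qBall ρ x' l ×ˢ Ioo a b) ^ (q - 1) * v ^ q := by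
        calc _ ≤ dualMeasure μ q ω (qBall ρ x (R * l) ×ˢ
                Ioo (t + G) (t + G + R ^ p * l ^ p)) ^ (q - 1) *
              (weightMeasure μ ω (qBall ρ x (R * l) ×ˢ Ioo (t - R ^ p * l ^ p) t) *
                dualMeasure μ q ω (qBall ρ x' l ×ˢ Ioo a b) ^ (q - 1)) := by
              refine mul_le_mul' (ENNReal.rpow_le_rpow (measure_mono (prod_mono hB
                (Ioo_subset_Ioo le_rfl (by linarith)))) hq1.le)
                ((hHol a b hab).trans (mul_le_mul' (measure_mono (prod_mono hB' hsub)) le_rfl))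
          _ = dualMeasure μ q ω (qBall ρ x' l ×ˢ Ioo a b) ^ (q - 1) *
              (weightMeasure μ ω (qBall ρ x (R * l) ×ˢ Ioo (t - R ^ p * l ^ p) t) *
                dualMeasure μ q ω (qBall ρ x (R * l) ×ˢ
                  Ioo (t + G) (t + G + R ^ p * l ^ p)) ^ (q - 1)) := by ring
          _ ≤ dualMeasure μ q ω (qBall ρ x' l ×ˢ Ioo a b) ^ (q - 1) * (M * v ^ q) :=
              mul_le_mul' le_rfl (h1.trans hbig)
          _ = _ := by ring
      exact (ENNReal.mul_le_mul_iff_left hvq0 hvqt).1 h2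
  have hARp : 0 ≤ A * R ^ p := by positivity
  have hRp : 1 ≤ R ^ p := Real.one_le_rpow hR1 hp.le
  have hM1 : (M : ℝ≥0∞) ≤ (max 1 (max M (M ^ (1 / (q - 1)))) : ℝ≥0) := by
    exact_mod_cast (le_max_left _ _).trans (le_max_right _ _)
  have hM2 : (M : ℝ≥0∞) ^ (1 / (q - 1)) ≤ (max 1 (max M (M ^ (1 / (q - 1)))) : ℝ≥0) := by
    rw [← ENNReal.coe_rpow_of_nonneg _ (by positivity)]
    exact_mod_cast (le_max_right _ _).trans (le_max_right _ _)
  refine ⟨max 1 (max M (M ^ (1 / (q - 1)))), A * R ^ p + 1, le_max_left _ _, by linarith, ?_, ?_⟩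
  · intro x x' l hl hxx'
    obtain ⟨G, hG, hest⟩ := key x x' l hl hxx'
    have hlp : 0 < l ^ p := Real.rpow_pos_of_pos hl p
    have hlRl : l ^ p ≤ R ^ p * l ^ p := le_mul_of_one_le_left hlp.le hRp
    refine ⟨G + l ^ p, ⟨by linarith [hG.1], by linarith [hG.2]⟩, fun t => ?_⟩
    refine ((hest t).1 _ _ (Ioo_subset_Ioo ?_ ?_) ?_).trans (mul_le_mul' hM1 le_rfl)
    · linarith
    · linarith
    · ring
  · intro x x' l hl hxx'
    obtain ⟨G, hG, hest⟩ := key x x' l hl hxx'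
    have hlp : 0 < l ^ p := Real.rpow_pos_of_pos hl p
    have hlRl : l ^ p ≤ R ^ p * l ^ p := le_mul_of_one_le_left hlp.le hRp
    refine ⟨G + l ^ p, ⟨by linarith [hG.1], by linarith [hG.2]⟩, fun t => ?_⟩
    rw [reversedDualMeasure_prod_Ioo (hX.measurableSet_qBall _ _),
      reversedDualMeasure_prod_Ioo (hX.measurableSet_qBall _ _)]
    have h1 := (hest (-t - G)).2 (-(t + (G + l ^ p))) (-(t + (G + l ^ p) - l ^ p))
      (Ioo_subset_Ioo (by linarith) (by linarith)) (by ring)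
    rw [show -t - G + G = -t by ring, show -t + l ^ p = -(t - l ^ p) by ring] at h1
    have h2 := ENNReal.rpow_le_rpow h1 (show 0 ≤ 1 / (q - 1) by positivity)
    rw [ENNReal.mul_rpow_of_nonneg _ _ (by positivity), ← ENNReal.rpow_mul, ← ENNReal.rpow_mul,
      mul_one_div_cancel hq1.ne', ENNReal.rpow_one, ENNReal.rpow_one] at h2
    exact h2.trans (mul_le_mul' hM2 le_rfl)

end Chain

section ChainIteration

variable {X : Type*} [MeasurableSpace X] {ρ : X → X → ℝ} {K₀ : ℝ} {p κ d : ℝ}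
  {ν : Measure (X × ℝ)} {C : ℝ≥0}

theorem HasForwardSteps.chain (hρ : IsQuasiMetric ρ K₀) {K : ℝ}
    (hgeo : ∀ (s : ℝ), 0 < s → ∀ x y : X, s ≤ ρ x y →
      ∃ (m : ℕ) (u : ℕ → X), 1 ≤ m ∧ u 0 = x ∧ u m = y ∧
        ∀ i < m, ρ (u i) (u (i + 1)) ≤ K * s ∧ ρ (u (i + 1)) (u m) ≤ ρ (u i) (u m) - s)
    (hK : K ≤ κ) (hκ : 1 ≤ κ) (hC : 1 ≤ C) (h : HasForwardSteps ρ p ν κ C d) (z : X) {l : ℝ}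
    (hl : 0 < l) (M : ℕ) (x : X) (hx : ρ x z ≤ M * l) (t : ℝ) :
    ∃ T ∈ Icc t (t + M * (d * l ^ p)), ν (qBall ρ x l ×ˢ Ioo (t - l ^ p) t) ≤
      (C : ℝ≥0∞) ^ M * ν (qBall ρ z l ×ˢ Ioo (T - l ^ p) T) := by
  have hlp : 0 < l ^ p := Real.rpow_pos_of_pos hl p
  have hC' : (1 : ℝ≥0∞) ≤ C := by exact_mod_cast hC
  induction M generalizing x t with
  | zero =>
    have h0 : ρ x z = 0 := le_antisymm (by simpa using hx) (hρ.nonneg _ _)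
    obtain rfl := (hρ.eq_zero_iff x z).1 h0
    exact ⟨t, by simp, by simp⟩
  | succ M ih =>
    rcases lt_or_ge (ρ x z) l with hlt | hge
    · obtain ⟨e, he, hest⟩ := h x z l hl (by nlinarith)
      refine ⟨t + e, ⟨by linarith [he.1], ?_⟩, (hest t).trans ?_⟩
      · have : 0 ≤ (M : ℝ) * (d * l ^ p) :=
          mul_nonneg (Nat.cast_nonneg _) (by linarith [he.1, he.2])
        push_cast
        linarith [he.2]
      · exact mul_le_mul' (le_self_pow₀ hC' (by omega)) le_rfl
    · obtain ⟨m, u, hm, hu0, hum, hu⟩ := hgeo l hl x z hge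
      have h1 := hu 0 (by omega)
      rw [hu0, hum] at h1
      obtain ⟨e, he, hest⟩ := h x (u (0 + 1)) l hl (h1.1.trans (by gcongr))
      obtain ⟨T, hT, hT'⟩ := ih (u (0 + 1)) (by push_cast at hx; linarith [h1.2]) (t + e)
      refine ⟨T, ⟨by linarith [hT.1, he.1], ?_⟩, ?_⟩
      · push_cast
        linarith [hT.2, he.2]
      · calc _ ≤ _ := hest t
          _ ≤ C * ((C : ℝ≥0∞) ^ M * ν (qBall ρ z l ×ˢ Ioo (T - l ^ p) T)) := by gcongr
          _ = _ := by rw [pow_succ]; ring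

theorem HasForwardSteps.wait (hρ : IsQuasiMetric ρ K₀) (hκ : 0 ≤ κ) (hC : 1 ≤ C)
    (h : HasForwardSteps ρ p ν κ C d) (z : X) {l : ℝ} (hl : 0 < l) (S : ℝ) (J : ℕ) (T : ℝ)
    (h1 : T ≤ S + d * l ^ p) (h2 : S - T ≤ J * l ^ p) :
    ∃ T' ∈ Icc S (S + d * l ^ p), ν (qBall ρ z l ×ˢ Ioo (T - l ^ p) T) ≤
      (C : ℝ≥0∞) ^ J * ν (qBall ρ z l ×ˢ Ioo (T' - l ^ p) T') := by
  have hC' : (1 : ℝ≥0∞) ≤ C := by exact_mod_cast hC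
  induction J generalizing T with
  | zero => exact ⟨T, ⟨by simp at h2; linarith, h1⟩, by simp⟩
  | succ J ih =>
    rcases le_or_gt S T with hST | hTS
    · exact ⟨T, ⟨hST, h1⟩, le_mul_of_one_le_left' (one_le_pow₀ hC')⟩
    · obtain ⟨e, he, hest⟩ := h z z l hl (by rw [hρ.self_eq_zero]; positivity)
      push_cast at h2
      obtain ⟨T', hT', hle⟩ := ih (T + e) (by linarith [he.2]) (by linarith [he.1])
      refine ⟨T', hT', ?_⟩
      calc _ ≤ _ := hest T
        _ ≤ C * ((C : ℝ≥0∞) ^ J * ν (qBall ρ z l ×ˢ Ioo (T' - l ^ p) T')) := by gcongr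
        _ = _ := by rw [pow_succ]; ring

/-- The mass of a large cylinder is controlled by that of a small one that lies later in time. -/
theorem HasForwardSteps.measure_le_small [TopologicalSpace X] {μ : Measure X}
    (hX : IsHomogeneousType ρ K₀ μ) {K : ℝ}
    (hgeo : ∀ (s : ℝ), 0 < s → ∀ x y : X, s ≤ ρ x y →
      ∃ (m : ℕ) (u : ℕ → X), 1 ≤ m ∧ u 0 = x ∧ u m = y ∧
        ∀ i < m, ρ (u i) (u (i + 1)) ≤ K * s ∧ ρ (u (i + 1)) (u m) ≤ ρ (u i) (u m) - s)
    (hK : K ≤ κ) (hκ : 1 ≤ κ) (hC : 1 ≤ C) (hd : 1 ≤ d) (h : HasForwardSteps ρ p ν κ C d)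
    (m J : ℕ) : ∃ C' : ℝ≥0, ∀ (x : X) (l t S : ℝ), 0 < l → t + (m * d + 1) * l ^ p ≤ S →
      S ≤ t + J * l ^ p →
      ν (qBall ρ x (m * l) ×ˢ Ioo (t - (m * l) ^ p) t) ≤
        C' * ν (qBall ρ x l ×ˢ Ioo (S - l ^ p) (S + d * l ^ p)) := by
  obtain ⟨n, hn⟩ := hX.exists_cover_qBall m
  set N : ℕ := ⌈2 * (m : ℝ) ^ p⌉₊ with hN
  refine ⟨n * (N * C ^ (m + (J + N))), fun x l t S hl hS1 hS2 => ?_⟩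
  have hlp : 0 < l ^ p := Real.rpow_pos_of_pos hl p
  have hmlp : ((m : ℝ) * l) ^ p = (m : ℝ) ^ p * l ^ p := Real.mul_rpow (Nat.cast_nonneg _) hl.le
  obtain ⟨Y, hYn, hY1, hY2⟩ := hn x l hl
  set tj : ℕ → ℝ := fun j => t - (j : ℝ) * l ^ p / 2 with htj
  have hcov : qBall ρ x (m * l) ×ˢ Ioo (t - (m * l) ^ p) t ⊆
      ⋃ y ∈ Y, ⋃ j ∈ Finset.range N, qBall ρ y l ×ˢ Ioo (tj j - l ^ p) (tj j) := by
    rintro ⟨w, s⟩ ⟨hw, hs1, hs2⟩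
    simp only at hw hs1 hs2
    obtain ⟨y, hy, hyw⟩ := hY2 w hw
    set a : ℝ := 2 * (t - s) / l ^ p with ha
    have ha0 : 0 < a := by
      have : 0 < t - s := by linarith
      positivity
    have has : t - s = a * l ^ p / 2 := by rw [ha]; field_simp
    have haN : a < 2 * (m : ℝ) ^ p := by
      rw [ha, div_lt_iff₀ hlp]
      rw [hmlp] at hs1
      linarith
    have hceil : 0 < ⌈a⌉₊ := Nat.ceil_pos.2 ha0
    obtain ⟨j, hj⟩ : ∃ j, ⌈a⌉₊ = j + 1 := ⟨⌈a⌉₊ - 1, by omega⟩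
    have hja : (j : ℝ) < a := by
      have := Nat.ceil_lt_add_one ha0.le
      rw [hj] at this
      push_cast at this
      linarith
    have haj : a ≤ (j : ℝ) + 1 := by
      have := Nat.le_ceil a
      rw [hj] at this
      exact_mod_cast this
    refine mem_biUnion hy (mem_biUnion (x := j) ?_ ⟨hyw, ?_, ?_⟩)
    · have : ⌈a⌉₊ ≤ N := Nat.ceil_mono haN.le
      simp only [Finset.coe_range, mem_Iio]
      omega
    · simp only [htj]
      have : a * l ^ p ≤ ((j : ℝ) + 1) * l ^ p := by gcongr
      linarith
    · simp only [htj]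
      have : (j : ℝ) * l ^ p < a * l ^ p := by gcongr
      linarith
  have hpiece : ∀ y ∈ Y, ∀ j ∈ Finset.range N,
      ν (qBall ρ y l ×ˢ Ioo (tj j - l ^ p) (tj j)) ≤
        (C : ℝ≥0∞) ^ (m + (J + N)) * ν (qBall ρ x l ×ˢ Ioo (S - l ^ p) (S + d * l ^ p)) := by
    intro y hy j hj
    have hjN : (j : ℝ) ≤ N := by exact_mod_cast (Finset.mem_range.1 hj).le
    have hj0 : (0 : ℝ) ≤ j := Nat.cast_nonneg _
    have htj1 : tj j ≤ t + l ^ p / 2 := by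
      simp only [htj]
      have : 0 ≤ (j : ℝ) * l ^ p := by positivity
      linarith
    have htj2 : t ≤ tj j + N * l ^ p := by
      simp only [htj]
      have h3 : (j : ℝ) * l ^ p ≤ N * l ^ p := by gcongr
      have : 0 ≤ (N : ℝ) * l ^ p := by positivity
      linarith
    obtain ⟨T, hT, hle1⟩ := h.chain hX.quasiMetric hgeo hK hκ hC x hl m y
      (by rw [hX.quasiMetric.symm]; exact (hY1 y hy).le) (tj j)
    have hdlp : 0 ≤ d * l ^ p := by positivity
    obtain ⟨T', hT', hle2⟩ := h.wait hX.quasiMetric (by linarith) hC x hl S (J + N) T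
      (by linarith [hT.2]) (by push_cast; linarith [hT.1])
    calc _ ≤ _ := hle1
      _ ≤ (C : ℝ≥0∞) ^ m * ((C : ℝ≥0∞) ^ (J + N) *
          ν (qBall ρ x l ×ˢ Ioo (T' - l ^ p) T')) := by gcongr
      _ ≤ (C : ℝ≥0∞) ^ m * ((C : ℝ≥0∞) ^ (J + N) *
          ν (qBall ρ x l ×ˢ Ioo (S - l ^ p) (S + d * l ^ p))) := by
          gcongr
          · linarith [hT'.1]
          · exact hT'.2
      _ = _ := by rw [pow_add]; ring
  calc _ ≤ _ := measure_mono hcov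
    _ ≤ ∑ y ∈ Y, ∑ j ∈ Finset.range N, ν (qBall ρ y l ×ˢ Ioo (tj j - l ^ p) (tj j)) :=
        (measure_biUnion_finset_le _ _).trans
          (Finset.sum_le_sum fun y _ => measure_biUnion_finset_le _ _)
    _ ≤ ∑ y ∈ Y, ∑ j ∈ Finset.range N, (C : ℝ≥0∞) ^ (m + (J + N)) *
          ν (qBall ρ x l ×ˢ Ioo (S - l ^ p) (S + d * l ^ p)) :=
        Finset.sum_le_sum fun y hy => Finset.sum_le_sum fun j hj => hpiece y hy j hj
    _ = (Y.card : ℝ≥0∞) * (N * ((C : ℝ≥0∞) ^ (m + (J + N)) *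
          ν (qBall ρ x l ×ˢ Ioo (S - l ^ p) (S + d * l ^ p)))) := by
        simp
    _ ≤ (n : ℝ≥0∞) * (N * ((C : ℝ≥0∞) ^ (m + (J + N)) *
          ν (qBall ρ x l ×ˢ Ioo (S - l ^ p) (S + d * l ^ p)))) := by
        gcongr
    _ = _ := by push_cast; ring

end ChainIteration

theorem exists_nat_mul_add_le_rpow {p : ℝ} (hp : 1 < p) {a b ε : ℝ} (hb : 0 ≤ b) (hε : 0 < ε) :
    ∃ m : ℕ, 1 ≤ m ∧ a * m + b ≤ ε * (m : ℝ) ^ p := by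
  have h1 : Filter.Tendsto (fun m : ℕ => (m : ℝ) ^ (p - 1)) Filter.atTop Filter.atTop :=
    (tendsto_rpow_atTop (by linarith)).comp tendsto_natCast_atTop_atTop
  obtain ⟨m, hm1, hm⟩ := ((h1.eventually_ge_atTop ((a + b) / ε)).and
    (Filter.eventually_ge_atTop 1)).exists
  refine ⟨m, hm, ?_⟩
  have hm' : (1 : ℝ) ≤ m := by exact_mod_cast hm
  have e : (m : ℝ) ^ p = m ^ (p - 1) * m := by
    conv_lhs => rw [show p = (p - 1) + 1 by ring]
    rw [Real.rpow_add (by linarith), Real.rpow_one]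
  rw [div_le_iff₀ hε] at hm1
  rw [e]
  nlinarith

section TimeLag

variable {X : Type*} [TopologicalSpace X] [MeasurableSpace X] {ρ : X → X → ℝ} {K₀ : ℝ}
  {μ : Measure X} {p q : ℝ} {ω : X × ℝ → ℝ}

/-- Lag estimates with bounded lags self-improve to every positive lag. -/
theorem HasBoundedLagEstimates.hasLagEstimate (hX : IsHomogeneousType ρ K₀ μ)
    (hgeo : MonotoneGeodesic ρ) (hp : 1 < p) (hq : 1 < q) (hω : IsWeight ρ p μ ω)
    (h : HasBoundedLagEstimates ρ μ p q ω) {ε : ℝ} (hε : 0 < ε) :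
    ∃ C : ℝ≥0, ∀ (x : X) (l : ℝ), 0 < l → HasLagEstimate ρ μ p q ω C x l (ε * l ^ p) := by
  have hq0 : 0 < q := by linarith
  have hp0 : 0 < p := by linarith
  obtain ⟨K, hK, hgeoK⟩ := hgeo
  obtain ⟨C₁, d, hC₁, hd, hfW, hfS⟩ := h.hasForwardSteps hX hp0 hq hω (κ := max K 1)
    (zero_le_one.trans (le_max_right _ _))
  obtain ⟨A, C, hAC⟩ := h
  have hA0 : 0 ≤ A := by
    obtain ⟨x⟩ := hX.nonempty
    obtain ⟨G, hG, -⟩ := hAC x 1 one_pos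
    have := hG.1.trans hG.2
    simpa using this
  obtain ⟨m, hm1, hm⟩ := exists_nat_mul_add_le_rpow hp (a := 2 * d)
    (b := 2 + 2 * d + A * (d + 1)) (by positivity) hε
  have hm0 : (0 : ℝ) < m := by exact_mod_cast hm1
  obtain ⟨CW, hCW⟩ := hfW.measure_le_small hX hgeoK (le_max_left _ _) (le_max_right _ _) hC₁ hd m
    ⌈(m : ℝ) * d + 1⌉₊
  obtain ⟨CS, hCS⟩ := hfS.measure_le_small hX hgeoK (le_max_left _ _) (le_max_right _ _) hC₁ hd m
    ⌈ε * (m : ℝ) ^ p⌉₊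
  set b : ℝ := (d + 1) ^ (1 / p) with hb
  have hb1 : 1 ≤ b := Real.one_le_rpow (by linarith) (by positivity)
  have hbp : b ^ p = d + 1 := by
    rw [hb, ← Real.rpow_mul (by positivity), one_div_mul_cancel hp0.ne', Real.rpow_one]
  obtain ⟨C', hC'⟩ := hX.exists_measure_qBall_mul_le (b / m)
  refine ⟨CW * CS ^ (q - 1) * (C * (C' * ((b / m) ^ p).toNNReal) ^ q), fun x r hr t => ?_⟩
  obtain ⟨l, hl, rfl⟩ : ∃ l, 0 < l ∧ r = m * l := ⟨r / m, by positivity, by field_simp⟩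
  have hlp : 0 < l ^ p := Real.rpow_pos_of_pos hl p
  have hmlp : ((m : ℝ) * l) ^ p = (m : ℝ) ^ p * l ^ p := Real.mul_rpow (Nat.cast_nonneg _) hl.le
  have hblp : (b * l) ^ p = (d + 1) * l ^ p := by rw [Real.mul_rpow (by linarith) hl.le, hbp]
  obtain ⟨G, hG, hest⟩ := hAC x (b * l) (by positivity)
  rw [hblp] at hG
  set S := t + (m * d + 1) * l ^ p with hS
  set t₀ := S + d * l ^ p with ht₀
  have hB : qBall ρ x l ⊆ qBall ρ x (b * l) :=
    qBall_subset_qBall (le_mul_of_one_le_left hl.le hb1)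
  have hW := hCW x l t S hl le_rfl (by
    rw [hS]
    gcongr
    exact Nat.le_ceil _)
  set t' := -(t + ε * (m * l) ^ p) with ht'
  set S' := -t₀ - G - d * l ^ p with hS'
  have hS1 : t' + (m * d + 1) * l ^ p ≤ S' := by
    have h1 : (2 * d * m + (2 + 2 * d + A * (d + 1))) * l ^ p ≤ ε * (m : ℝ) ^ p * l ^ p := by gcongr
    rw [ht', hS', ht₀, hS, hmlp]
    linarith [hG.2]
  have hS2 : S' ≤ t' + ⌈ε * (m : ℝ) ^ p⌉₊ * l ^ p := by
    have h1 : ε * (m : ℝ) ^ p * l ^ p ≤ ⌈ε * (m : ℝ) ^ p⌉₊ * l ^ p := by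
      gcongr
      exact Nat.le_ceil _
    have h2 : 0 ≤ (m : ℝ) * d * l ^ p := by positivity
    have h3 : 0 ≤ d * l ^ p := by positivity
    rw [ht', hS', ht₀, hS, hmlp]
    linarith [hG.1]
  have hdual := hCS x l t' S' hl hS1 hS2
  rw [reversedDualMeasure_prod_Ioo (hX.measurableSet_qBall _ _),
    reversedDualMeasure_prod_Ioo (hX.measurableSet_qBall _ _),
    show -t' = t + ε * (m * l) ^ p by rw [ht']; ring,
    show -(t' - (m * l) ^ p) = t + ε * (m * l) ^ p + (m * l) ^ p by rw [ht']; ring] at hdual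
  have h1 := hest t₀
  rw [hblp] at h1
  have hV1 : weightMeasure μ ω (qBall ρ x l ×ˢ Ioo (S - l ^ p) (S + d * l ^ p)) ≤
      weightMeasure μ ω (qBall ρ x (b * l) ×ˢ Ioo (t₀ - (d + 1) * l ^ p) t₀) :=
    measure_mono (prod_mono hB (Ioo_subset_Ioo (by rw [ht₀]; linarith) le_rfl))
  have hV2 : dualMeasure μ q ω (qBall ρ x l ×ˢ Ioo (-(S' + d * l ^ p)) (-(S' - l ^ p))) ≤
      dualMeasure μ q ω (qBall ρ x (b * l) ×ˢ Ioo (t₀ + G) (t₀ + G + (d + 1) * l ^ p)) :=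
    measure_mono (prod_mono hB (Ioo_subset_Ioo (by rw [hS']; linarith) (by rw [hS']; linarith)))
  have hμ : μ (qBall ρ x (b * l)) ≤ C' * μ (qBall ρ x (m * l)) := by
    have := hC' x (m * l) (by positivity)
    rwa [show b / m * (m * l) = b * l by field_simp] at this
  have hdur : (d + 1) * l ^ p = (b / m) ^ p * (m * l) ^ p := by
    rw [← hblp, ← Real.mul_rpow (by positivity) (by positivity)]
    congr 1
    field_simp
  calc _ ≤ (CW * weightMeasure μ ω (qBall ρ x (b * l) ×ˢ Ioo (t₀ - (d + 1) * l ^ p) t₀)) *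
        (CS * dualMeasure μ q ω (qBall ρ x (b * l) ×ˢ
          Ioo (t₀ + G) (t₀ + G + (d + 1) * l ^ p))) ^ (q - 1) :=
        mul_le_mul' (hW.trans (mul_le_mul' le_rfl hV1))
          (ENNReal.rpow_le_rpow (hdual.trans (mul_le_mul' le_rfl hV2)) (by linarith))
    _ = CW * (CS : ℝ≥0∞) ^ (q - 1) *
        (weightMeasure μ ω (qBall ρ x (b * l) ×ˢ Ioo (t₀ - (d + 1) * l ^ p) t₀) *
        dualMeasure μ q ω (qBall ρ x (b * l) ×ˢ
          Ioo (t₀ + G) (t₀ + G + (d + 1) * l ^ p)) ^ (q - 1)) := by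
        rw [ENNReal.mul_rpow_of_nonneg _ _ (by linarith)]
        ring
    _ ≤ CW * (CS : ℝ≥0∞) ^ (q - 1) *
        (C * (μ (qBall ρ x (b * l)) * ENNReal.ofReal ((d + 1) * l ^ p)) ^ q) :=
        mul_le_mul' le_rfl h1
    _ ≤ CW * (CS : ℝ≥0∞) ^ (q - 1) *
        (C * ((C' * μ (qBall ρ x (m * l))) *
          (ENNReal.ofReal ((b / m) ^ p) * ENNReal.ofReal ((m * l) ^ p))) ^ q) := by
        rw [hdur, ENNReal.ofReal_mul (by positivity)]
        gcongr
    _ = _ := by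
        rw [mul_mul_mul_comm (C' : ℝ≥0∞), ENNReal.mul_rpow_of_nonneg _ (μ _ * _) hq0.le]
        simp only [ENNReal.coe_mul]
        rw [ENNReal.coe_rpow_of_nonneg _ (by linarith), ENNReal.coe_rpow_of_nonneg _ hq0.le,
          ENNReal.coe_mul, ← mul_assoc, ← mul_assoc]
        rw [mul_assoc (_ * _) (C : ℝ≥0∞)]
        rfl

end TimeLag

section Characterization

variable {X : Type*} [TopologicalSpace X] [MeasurableSpace X] {ρ : X → X → ℝ} {K₀ : ℝ}
  {μ : Measure X} {p q γ : ℝ} {ω : X × ℝ → ℝ}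

theorem HasBoundedLagEstimates.memAqPlus (hX : IsHomogeneousType ρ K₀ μ)
    (hgeo : MonotoneGeodesic ρ) (hp : 1 < p) (hq : 1 < q) (hω : IsWeight ρ p μ ω)
    (h : HasBoundedLagEstimates ρ μ p q ω) (hγ : γ ∈ Ioo (0 : ℝ) 1) : MemAqPlus ρ p μ q γ ω := by
  obtain ⟨C, hC⟩ := h.hasLagEstimate hX hgeo hp hq hω (ε := 2 * γ) (by linarith [hγ.1])
  exact MemAqPlus.of_hasLagEstimate hX hq hγ.1.le hγ.2 hω hC

theorem HasBoundedLagEstimates.weakBounded (hX : IsHomogeneousType ρ K₀ μ)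
    (hgeo : MonotoneGeodesic ρ) (D : AdjacentDyadicSystem ρ K₀ μ) (hp : 1 < p) (hq : 1 < q)
    (hω : IsWeight ρ p μ ω) (h : HasBoundedLagEstimates ρ μ p q ω) (hγ : γ ∈ Ioo (0 : ℝ) 1) :
    MaximalPlusWeakBounded D p q γ ω := by
  set Λ : ℝ := max 1 (2 * K₀ * D.C₀)
  have hΛ : 0 < Λ := lt_of_lt_of_le one_pos (le_max_left _ _)
  obtain ⟨C, hC⟩ := h.hasLagEstimate hX hgeo hp hq hω
    (ε := γ / Λ ^ p) (div_pos hγ.1 (Real.rpow_pos_of_pos hΛ p))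
  obtain ⟨C', hC'⟩ := AdjacentDyadicSystem.CubeCondition.of_hasLagEstimate hX D (by linarith) hq
    hγ.1.le (le_max_left _ _) (le_max_right _ _) hC
  exact hC'.weakBounded hX hp.le hq hγ.1.le hγ.2 hω

theorem MaximalPlusWeakBounded.hasBoundedLagEstimates (hX : IsHomogeneousType ρ K₀ μ)
    (hgeo : MonotoneGeodesic ρ) {D : AdjacentDyadicSystem ρ K₀ μ} (hp : 1 < p) (hq : 1 < q)
    (hω : IsWeight ρ p μ ω) (hγ : γ ∈ Ioo (0 : ℝ) 1) (h : MaximalPlusWeakBounded D p q γ ω) :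
    HasBoundedLagEstimates ρ μ p q ω := by
  obtain ⟨A, C, hAC⟩ :=
    D.exists_hasLagEstimate_of_weakBounded hX hgeo (by linarith) hq hγ.2 hω h
  refine ⟨A, C, fun x l hl => ?_⟩
  obtain ⟨L, hL, hest⟩ := hAC x l hl
  exact ⟨γ * L, ⟨mul_nonneg hγ.1.le hL.1,
    (mul_le_of_le_one_left hL.1 hγ.2.le).trans hL.2⟩, hest⟩

theorem memAqPlus_zero_iff_weakBounded (hX : IsHomogeneousType ρ K₀ μ)
    (hgeo : MonotoneGeodesic ρ) (D : AdjacentDyadicSystem ρ K₀ μ) (hp : 1 < p) (hq : 1 < q)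
    (hω : IsWeight ρ p μ ω) : MemAqPlus ρ p μ q 0 ω ↔ MaximalPlusWeakBounded D p q 0 ω := by
  constructor
  · intro h
    obtain ⟨C, hC⟩ := h.hasLagEstimate_zero hX hq
    obtain ⟨C', hC'⟩ := AdjacentDyadicSystem.CubeCondition.of_hasLagEstimate hX D
      (γ := 0) (p := p) (by linarith) hq le_rfl (le_max_left 1 _) (le_max_right _ _)
      (fun x l hl => by simpa using hC x l hl)
    exact hC'.weakBounded hX hp.le hq le_rfl one_pos hω
  · intro h
    obtain ⟨A, C, hAC⟩ :=
      D.exists_hasLagEstimate_of_weakBounded hX hgeo (by linarith) hq one_pos hω h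
    refine MemAqPlus.of_hasLagEstimate hX hq le_rfl one_pos hω (C := C) fun x l hl => ?_
    obtain ⟨L, -, hest⟩ := hAC x l hl
    simpa using hest

end Characterization

theorem theorem5p7 {X : Type u} [TopologicalSpace X] [MeasurableSpace X]
    (ρ : X → X → ℝ) (K₀ : ℝ) (μ : Measure X)
    (hX : IsHomogeneousType ρ K₀ μ) (hgeo : MonotoneGeodesic ρ)
    (D : AdjacentDyadicSystem.{u, v} ρ K₀ μ)
    (p q : ℝ) (hp : 1 < p) (hq : 1 < q)
    (ω : X × ℝ → ℝ) (hω : IsWeight ρ p μ ω) :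
    List.TFAE
      [∃ γ ∈ Ioo (0 : ℝ) 1, MemAqPlus ρ p μ q γ ω,
       ∀ γ ∈ Ioo (0 : ℝ) 1, MemAqPlus ρ p μ q γ ω,
       ∃ γ ∈ Ioo (0 : ℝ) 1, MaximalPlusWeakBounded D p q γ ω,
       ∀ γ ∈ Ioo (0 : ℝ) 1, MaximalPlusWeakBounded D p q γ ω] ∧
    (MemAqPlus ρ p μ q 0 ω ↔ MaximalPlusWeakBounded D p q 0 ω) := by
  have hhalf : (1 / 2 : ℝ) ∈ Ioo (0 : ℝ) 1 := ⟨by norm_num, by norm_num⟩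
  have hmem : ∀ γ ∈ Ioo (0 : ℝ) 1, MemAqPlus ρ p μ q γ ω → HasBoundedLagEstimates ρ μ p q ω :=
    fun γ hγ h => h.hasBoundedLagEstimates hX (by linarith) hq hγ.1.le hγ.2
  refine ⟨?_, memAqPlus_zero_iff_weakBounded hX hgeo D hp hq hω⟩
  tfae_have 2 → 1 := fun h => ⟨1 / 2, hhalf, h _ hhalf⟩
  tfae_have 4 → 3 := fun h => ⟨1 / 2, hhalf, h _ hhalf⟩
  tfae_have 3 → 2 := fun ⟨_, hγ, h⟩ _ hγ' =>
    (h.hasBoundedLagEstimates hX hgeo hp hq hω hγ).memAqPlus hX hgeo hp hq hω hγ'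
  tfae_have 1 → 4 := fun ⟨γ, hγ, h⟩ _ hγ' =>
    (hmem γ hγ h).weakBounded hX hgeo D hp hq hω hγ'
  tfae_finish
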